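/- Let $\Bbbk$ be a field of characteristic zero, let $a,b,p,q,t\in\Bbbk$ with $t\neq 0$, and let $V$ be the $\Bbbk$-vector space with basis $x_1,x_2,x_3$. Let $c\in GL(V\otimes V)$ be the braiding associated to the $R$-matrix $\mathfrak{R}_{1,3}$, that is, $$\begin{aligned} c(x_1\otimes x_1)&=t\,x_1\otimes x_1, & c(x_2\otimes x_1)&=t\,x_1\otimes x_2, & c(x_3\otimes x_1)&=t\,x_1\otimes x_3+ta\,x_1\otimes x_1,\\ c(x_1\otimes x_2)&=t\,x_2\otimes x_1, & c(x_2\otimes x_2)&=t\,x_2\otimes x_2, & c(x_3\otimes x_2)&=t\,x_2\otimes x_3+tb\,x_2\otimes x_1,\\ c(x_1\otimes x_3)&=t\,x_3\otimes x_1-ta\,x_1\otimes x_1, & c(x_2\otimes x_3)&=t\,x_3\otimes x_2-tb\,x_1\otimes x_2, \end{aligned}$$ $$c(x_3\otimes x_3)=t\,x_3\otimes x_3+tb\,x_3\otimes x_1+tq\,x_2\otimes x_2+tp\,x_2\otimes x_1-tb\,x_1\otimes x_3-tp\,x_1\otimes x_2-tab\,x_1\otimes x_1 .$$ Let $\mathfrak{B}(V)=T(V)/\mathcal{J}(V)$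 be its Nichols algebra, where $\mathcal{J}(V)=\bigoplus_{n\ge 2}\mathcal{J}_n(V)$ and $\mathcal{J}_n(V)\subseteq V^{\otimes n}$ is the kernel of the quantum symmetrizer $Q_n=\sum_{\sigma\in\mathbb{S}_n}\rho_n(M(\sigma))$. Here $\rho_n$ is the representation of the braid group $\mathbb{B}_n$ on $V^{\otimes n}$ induced by $c$, and $M:\mathbb{S}_n\to\mathbb{B}_n$ is the Matsumoto section. Let $\operatorname{GKdim}$ denote the Gelfand-Kirillov dimension. Then: 1. If $t^2\neq 1$, then $\mathfrak{B}(V)$ has no quadratic relations, i.e. $\mathcal{J}_2(V)=0$. 2. If $t=1$, then $$\mathcal{J}(V)=\langle x_2x_1-x_1x_2,\ x_3x_1-x_1x_3-a\,x_1^2,\ x_3x_2-x_2x_3-b\,x_1x_2\rangle,$$ the set $B_3=\{x_1^{a_1}x_2^{a_2}x_3^{a_3}: a_i\ge 0\}$ is a basis of $\mathfrak{B}(V)$, and $\operatorname{GKdim}\mathfrak{B}(V)=3$. 3. If $t=-1$ and $q\neq 0$, then $$\mathcal{J}(V)=\langle x_2x_1+x_1x_2,\ x_3x_1+x_1x_3,\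 x_3x_2+x_2x_3-b\,x_1x_2,\ x_1^2,\ x_2^2\rangle,$$ the set $B_1=\{x_1^{a_1}x_2^{a_2}x_3^{a_3}: a_i\ge 0,\ a_1,a_2<2\}$ is a basis of $\mathfrak{B}(V)$, and $\operatorname{GKdim}\mathfrak{B}(V)=1$. 4. If $t=-1$ and $q=0$, then $$\mathcal{J}(V)=\langle x_2x_1+x_1x_2,\ x_3x_1+x_1x_3,\ x_3x_2+x_2x_3-b\,x_1x_2,\ x_1^2,\ x_2^2,\ x_3^2-b\,x_1x_3-p\,x_1x_2\rangle,$$ the set $B_0=\{x_1^{a_1}x_2^{a_2}x_3^{a_3}: 0\le a_i<2\}$ is a basis of $\mathfrak{B}(V)$, $\operatorname{GKdim}\mathfrak{B}(V)=0$ and $\dim\mathfrak{B}(V)=8$. -/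

import Mathlib

open scoped TensorProduct

namespace Nichols

/-! ### Braided vector spaces -/

/-- A braiding on the `k`-vector space `V`: an invertible linear endomorphism `c` of `V ⊗ V` with
`(c ⊗ id)(id ⊗ c)(c ⊗ id) = (id ⊗ c)(c ⊗ id)(id ⊗ c)` on `V ⊗ V ⊗ V`. -/
structure Braiding (k V : Type*) [Field k] [AddCommGroup V] [Module k V] where
  /-- the map `c` -/
  toMap : V ⊗[k] V →ₗ[k] V ⊗[k] V
  bijective : Function.Bijective toMap
  braid_eq :
    let c₁ : Module.End k (V ⊗[k] (V ⊗[k] V)) :=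
      (TensorProduct.assoc k V V V).toLinearMap ∘ₗ toMap.rTensor V ∘ₗ
        (TensorProduct.assoc k V V V).symm.toLinearMap
    let c₂ : Module.End k (V ⊗[k] (V ⊗[k] V)) := toMap.lTensor V
    c₁ * c₂ * c₁ = c₂ * c₁ * c₂

/-! ### Reduced words in the symmetric group -/

/-- The simple transposition `s_i = (i  i+1)` of `{0, …, n - 1}`
(the identity if `i + 1 ≥ n`, a case that never occurs below). -/
def simpleTransposition (n i : ℕ) : Equiv.Perm (Fin n) :=
  if h : i + 1 < n then Equiv.swap ⟨i, Nat.lt_of_succ_lt h⟩ ⟨i + 1, h⟩ else 1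

/-- `w = [i₁, …, i_l]` is a reduced word of `σ`: `σ = s_{i₁} ⋯ s_{i_l}`, and no shorter word in the
simple transpositions has product `σ`. -/
def IsReducedWord {n : ℕ} (σ : Equiv.Perm (Fin n)) (w : List ℕ) : Prop :=
  (∀ i ∈ w, i + 1 < n) ∧ (w.map (simpleTransposition n)).prod = σ ∧
    ∀ w' : List ℕ, (w'.map (simpleTransposition n)).prod = σ → w.length ≤ w'.length

/-- Delete `j` from the domain of `σ` and `σ j` from its codomain, and renumber increasingly. -/
def removeAt {n : ℕ} (σ : Equiv.Perm (Fin (n + 1))) (j : Fin (n + 1)) : Equiv.Perm (Fin n) :=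
  Equiv.removeNone ((finSuccEquiv' j).symm.trans (σ.trans (finSuccEquiv' (σ j))))

/-- A reduced word of `σ` (see `isReducedWord_reducedWord`): with `j = σ⁻¹(0)` and `σ'` the
permutation left when `j ↦ 0` is removed from `σ`, write `σ = (1 ⊕ σ') ∘ s_0 s_1 ⋯ s_{j-1}`. -/
def reducedWord : (n : ℕ) → Equiv.Perm (Fin n) → List ℕ
  | 0, _ => []
  | n + 1, σ => (reducedWord n (removeAt σ (σ.symm 0))).map Nat.succ ++
      List.range (σ.symm 0 : ℕ)

theorem simpleTransposition_val (n i : ℕ) (h : i + 1 < n) (x : Fin n) :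
    (simpleTransposition n i x : ℕ) =
      if (x : ℕ) = i then i + 1 else if (x : ℕ) = i + 1 then i else x := by
  simp only [simpleTransposition, dif_pos h, Equiv.swap_apply_def, Fin.ext_iff]
  split_ifs <;> simp_all

theorem removeAt_spec {n : ℕ} (σ : Equiv.Perm (Fin (n + 1))) (j : Fin (n + 1)) (x : Fin n) :
    σ (j.succAbove x) = (σ j).succAbove (removeAt σ j x) := by
  have h := Equiv.removeNone_some
    ((finSuccEquiv' j).symm.trans (σ.trans (finSuccEquiv' (σ j)))) (x := x) ?_
  · simp only [Equiv.trans_apply, finSuccEquiv'_symm_some] at h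
    rw [← finSuccEquiv'_symm_some (σ j), Equiv.eq_symm_apply, ← h]
    rfl
  · simp only [Equiv.trans_apply, finSuccEquiv'_symm_some]
    obtain ⟨y, hy⟩ := Fin.exists_succAbove_eq (x := σ (j.succAbove x)) (y := σ j)
      (by simp [Fin.succAbove_ne])
    exact ⟨y, by rw [← hy, finSuccEquiv'_succAbove]⟩

theorem removeAt_unique {n : ℕ} (σ : Equiv.Perm (Fin (n + 1))) (j : Fin (n + 1))
    (τ : Equiv.Perm (Fin n)) (h : ∀ x, σ (j.succAbove x) = (σ j).succAbove (τ x)) :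
    removeAt σ j = τ := by
  ext x
  have := (removeAt_spec σ j x).symm.trans (h x)
  rw [Fin.succAbove_right_injective this]

theorem reducedWord_lt (n : ℕ) (σ : Equiv.Perm (Fin n)) : ∀ i ∈ reducedWord n σ, i + 1 < n := by
  induction n with
  | zero => simp [reducedWord]
  | succ n ih =>
    intro i hi
    simp only [reducedWord, List.mem_append, List.mem_map, List.mem_range] at hi
    rcases hi with ⟨a, ha, rfl⟩ | hi
    · have := ih _ a ha
      omega
    · have := (σ.symm 0).isLt
      omega

theorem prod_range_val (n : ℕ) : ∀ (j : ℕ) (_ : j < n) (x : Fin n),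
    ((((List.range j).map (simpleTransposition n)).prod x : Fin n) : ℕ) =
      if (x : ℕ) < j then (x : ℕ) + 1 else if (x : ℕ) = j then 0 else x := by
  intro j
  induction j with
  | zero => intro _ x; simp
  | succ j ih =>
    intro hj x
    rw [List.range_succ, List.map_append, List.prod_append, Equiv.Perm.mul_apply, ih (by omega)]
    simp only [List.map_cons, List.map_nil, List.prod_singleton, simpleTransposition_val n j hj]
    split_ifs <;> omega

theorem prod_map_succ (n : ℕ) (w : List ℕ) (hw : ∀ i ∈ w, i + 1 < n) :
    ((w.map Nat.succ).map (simpleTransposition (n + 1))).prod 0 = 0 ∧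
    ∀ x : Fin n, ((w.map Nat.succ).map (simpleTransposition (n + 1))).prod x.succ =
      ((w.map (simpleTransposition n)).prod x).succ := by
  induction w with
  | nil => simp
  | cons i w ih =>
    have h1 := hw i (by simp)
    obtain ⟨h0, hs⟩ := ih (fun a ha => hw a (by simp [ha]))
    refine ⟨?_, fun x => ?_⟩
    · simp only [List.map_cons, List.prod_cons, Equiv.Perm.mul_apply] at h0 ⊢
      rw [h0]
      ext
      rw [simpleTransposition_val _ _ (by omega)]
      simp
    · simp only [List.map_cons, List.prod_cons, Equiv.Perm.mul_apply] at hs ⊢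
      rw [hs]
      ext
      rw [simpleTransposition_val _ _ (by omega), Fin.val_succ, Fin.val_succ,
        simpleTransposition_val _ _ h1]
      split_ifs <;> omega

theorem prod_reducedWord (n : ℕ) (σ : Equiv.Perm (Fin n)) :
    ((reducedWord n σ).map (simpleTransposition n)).prod = σ := by
  induction n with
  | zero => exact Subsingleton.elim _ _
  | succ n ih =>
    set j := σ.symm 0 with hj
    have hσ : σ j = 0 := by simp [hj]
    obtain ⟨h0, hs⟩ := prod_map_succ n (reducedWord n (removeAt σ j)) (reducedWord_lt n _)
    rw [ih] at hs
    simp only [reducedWord, List.map_append, List.prod_append, ← hj]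
    refine Equiv.ext fun y => ?_
    rw [Equiv.Perm.mul_apply]
    have hr := prod_range_val (n + 1) j j.isLt y
    rcases eq_or_ne y j with hy | hy
    · have : ((List.range (j : ℕ)).map (simpleTransposition (n + 1))).prod y = 0 := by
        ext; rw [hr, hy]; simp
      rw [this, h0, hy, hσ]
    · obtain ⟨x, rfl⟩ := Fin.exists_succAbove_eq hy
      have : ((List.range (j : ℕ)).map (simpleTransposition (n + 1))).prod (j.succAbove x)
          = x.succ := by
        ext; rw [hr]
        simp only [Fin.succAbove, Fin.lt_def, Fin.val_succ, Fin.val_castSucc]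
        split_ifs <;> simp_all <;> omega
      rw [this, hs, removeAt_spec, hσ, Fin.zero_succAbove]

theorem length_reducedWord_mul (n i : ℕ) (hi : i + 1 < n) (σ : Equiv.Perm (Fin n)) :
    (reducedWord n (σ * simpleTransposition n i)).length ≤ (reducedWord n σ).length + 1 := by
  induction n generalizing i with
  | zero => omega
  | succ n ih =>
    set j := σ.symm 0 with hj
    set s := simpleTransposition (n + 1) i with hs
    have hσ : σ j = 0 := by simp [hj]
    have hss : ∀ x, s (s x) = x := fun x => by
      ext; rw [hs, simpleTransposition_val _ _ hi, simpleTransposition_val _ _ hi]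
      split_ifs <;> omega
    have hj' : (σ * s).symm 0 = s j := by
      rw [Equiv.symm_apply_eq, Equiv.Perm.mul_apply, hss, hσ]
    have hσ' : (σ * s) (s j) = 0 := by rw [Equiv.Perm.mul_apply, hss, hσ]
    have hjv : (s j : ℕ) = _ := simpleTransposition_val (n + 1) i hi j
    simp only [reducedWord, hj', ← hj, List.length_append, List.length_map, List.length_range]
    by_cases hc : (j : ℕ) = i ∨ (j : ℕ) = i + 1
    · have : removeAt (σ * s) (s j) = removeAt σ j := by
        refine removeAt_unique _ _ _ fun x => ?_
        rw [hσ', ← hσ, ← removeAt_spec, Equiv.Perm.mul_apply]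
        congr 1
        ext
        rw [hs, simpleTransposition_val _ _ hi, ← hs]
        simp only [Fin.succAbove, Fin.lt_def, Fin.val_castSucc]
        rw [hjv]
        split_ifs <;> simp_all <;> omega
      rw [this, hjv]
      split_ifs <;> omega
    · have hsj : s j = j := by ext; rw [hjv]; split_ifs <;> omega
      have hjn := j.isLt
      obtain ⟨m, hm, hmi⟩ : ∃ m, m + 1 < n ∧
          ((i + 1 < j ∧ m = i) ∨ ((j : ℕ) < i ∧ m + 1 = i)) := by
        rcases lt_or_ge (i + 1) (j : ℕ) with h | h
        · exact ⟨i, by omega, Or.inl ⟨h, rfl⟩⟩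
        · exact ⟨i - 1, by omega, Or.inr ⟨by omega, by omega⟩⟩
      have : removeAt (σ * s) (s j) = removeAt σ j * simpleTransposition n m := by
        refine removeAt_unique _ _ _ fun x => ?_
        rw [hσ', ← hσ, Equiv.Perm.mul_apply, Equiv.Perm.mul_apply, ← removeAt_spec, hsj]
        congr 1
        ext
        rw [hs, simpleTransposition_val _ _ hi]
        simp only [Fin.succAbove, Fin.lt_def, Fin.val_castSucc, apply_ite Fin.val, Fin.val_succ,
          simpleTransposition_val _ _ hm]
        split_ifs <;> omega
      rw [this, hsj]
      have := ih m hm (removeAt σ j)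
      omega

theorem length_reducedWord_le (n : ℕ) (w : List ℕ) :
    (reducedWord n ((w.map (simpleTransposition n)).prod)).length ≤ w.length := by
  induction w using List.reverseRecOn with
  | nil =>
    simp only [List.map_nil, List.prod_nil, List.length_nil, Nat.le_zero]
    induction n with
    | zero => rfl
    | succ n ih =>
      have : removeAt (1 : Equiv.Perm (Fin (n + 1))) 0 = 1 :=
        removeAt_unique _ _ _ fun x => by simp
      have h0 : (1 : Equiv.Perm (Fin (n + 1))).symm 0 = 0 := rfl
      simp [reducedWord, h0, this, ih]
  | append_singleton w i ih =>
    simp only [List.map_append, List.prod_append, List.map_cons, List.map_nil,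
      List.prod_singleton, List.length_append, List.length_singleton]
    by_cases hi : i + 1 < n
    · exact (length_reducedWord_mul n i hi _).trans (by omega)
    · rw [simpleTransposition, dif_neg hi, mul_one]
      omega

theorem isReducedWord_reducedWord (n : ℕ) (σ : Equiv.Perm (Fin n)) :
    IsReducedWord σ (reducedWord n σ) :=
  ⟨reducedWord_lt n σ, prod_reducedWord n σ, fun w' h => h ▸ length_reducedWord_le n w'⟩

/-! ### Quantum symmetrizers and Nichols algebras -/

section NicholsAlgebra

variable {k V : Type*} [Field k] [AddCommGroup V] [Module k V]

variable (k V) in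
/-- The identification `V ⊗ V = T²(V)`. -/
noncomputable def pairEquiv : V ⊗[k] V ≃ₗ[k] ⨂[k]^2 V :=
  let e : V ≃ₗ[k] ⨂[k]^1 V :=
    (PiTensorProduct.subsingletonEquiv (s := fun _ : Fin 1 => V) (0 : Fin 1)).symm
  TensorProduct.congr e e ≪≫ₗ
    (TensorPower.mulEquiv : ⨂[k]^1 V ⊗[k] ⨂[k]^1 V ≃ₗ[k] ⨂[k]^(1 + 1) V)

/-- `id^{⊗ i} ⊗ f ⊗ id^{⊗ j}` on `T^{i+2+j}(V) = Tⁱ(V) ⊗ T²(V) ⊗ Tʲ(V)`, for an endomorphism `f` of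
`V ⊗ V = T²(V)`. -/
noncomputable def applyAt (f : Module.End k (V ⊗[k] V)) (i j : ℕ) :
    Module.End k (⨂[k]^(i + 2 + j) V) :=
  let g : Module.End k (⨂[k]^(i + 2) V) :=
    TensorPower.mulEquiv.conj (((pairEquiv k V).conj f).lTensor (⨂[k]^i V))
  TensorPower.mulEquiv.conj (g.rTensor (⨂[k]^j V))

/-- The image `c_i` of the `i`-th standard generator of the braid group `𝔹_n` in `GL(Tⁿ(V))`: the
braiding acting on the tensor factors `i` and `i + 1` (factors are counted from `0`; the value is
the identity if there are no such factors, a case that never occurs below). -/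
noncomputable def braidGenerator (c : Braiding k V) (n i : ℕ) : Module.End k (⨂[k]^n V) :=
  if h : i + 2 + (n - (i + 2)) = n then
    (TensorPower.cast k V h).conj (applyAt c.toMap i (n - (i + 2)))
  else 1

/-- The quantum symmetrizer `Q_n = ∑_{σ ∈ S_n} ρ_n(M(σ))` in `End(Tⁿ(V))`. Here `M` is the Matsumoto
section: `ρ_n(M(σ)) = c_{i₁} ⋯ c_{i_l}` for a reduced word `s_{i₁} ⋯ s_{i_l}` of `σ`, and by the
braid equation it does not matter which one. -/
noncomputable def quantumSymmetrizer (c : Braiding k V) (n : ℕ) : Module.End k (⨂[k]^n V) :=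
  ∑ σ : Equiv.Perm (Fin n), ((reducedWord n σ).map (braidGenerator c n)).prod

/-- `J_n(V)`, the kernel of the `n`-th quantum symmetrizer, as a subspace of `T(V)`: the relations
of degree `n` of the Nichols algebra. -/
noncomputable def relations (c : Braiding k V) (n : ℕ) : Submodule k (TensorAlgebra k V) :=
  (LinearMap.ker (quantumSymmetrizer c n)).map TensorPower.toTensorAlgebra

/-- `J(V) = ⨁_{n ≥ 2} J_n(V)`, the space of all relations of the Nichols algebra. -/
noncomputable def definingIdeal (c : Braiding k V) : Submodule k (TensorAlgebra k V) :=
  ⨆ n ≥ 2, relations c n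

/-- The Nichols algebra `𝔅(V) = T(V) / J(V)`. -/
abbrev NicholsAlgebra (c : Braiding k V) : Type _ :=
  RingQuot fun x y : TensorAlgebra k V => x ∈ definingIdeal c ∧ y = 0

/-- The image in `𝔅(V)` of a vector `v` of `V`. -/
noncomputable def NicholsAlgebra.ι (c : Braiding k V) (v : V) : NicholsAlgebra c :=
  RingQuot.mkAlgHom k _ (TensorAlgebra.ι k v)

end NicholsAlgebra

/-! ### Gelfand-Kirillov dimension -/

/-- The Gelfand-Kirillov dimension of a (nonzero) `k`-algebra `A`: the supremum over all
finite-dimensional subspaces `W` of `A` of `limsup_n log dim(k + W + ⋯ + Wⁿ) / log n`. -/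
noncomputable def gkDim (k A : Type*) [Field k] [Ring A] [Algebra k A] : EReal :=
  ⨆ W : {W : Submodule k A // W.FG},
    Filter.limsup
      (fun n : ℕ =>
        ((Real.log (Module.finrank k ↥((1 ⊔ W.1) ^ n)) / Real.log n : ℝ) : EReal))
      Filter.atTop

/-! ### Braidings given by `R`-matrices of rank three -/

section RankThree

variable {k : Type*} [Field k]

/-- The basis vectors `x_1, x_2, x_3` of `V = k³`, here numbered `0, 1, 2`. -/
def x (k : Type*) [Field k] (i : Fin 3) : Fin 3 → k := Pi.single i 1

/-- The linear map `c(x_i ⊗ x_j) = ∑_{k,l} r^{ij}_{kl} x_k ⊗ x_l` attached to a `9 × 9` matrix with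
columns `R^{11}, R^{21}, R^{31}, R^{12}, R^{22}, R^{32}, R^{13}, R^{23}, R^{33}`, where the entries
of the column `R^{ij}` are
`r^{ij}_{11}, r^{ij}_{12}, r^{ij}_{13}, r^{ij}_{21}, …, r^{ij}_{33}` from top to bottom. -/
noncomputable def mapOfMatrix (R : Matrix (Fin 9) (Fin 9) k) :
    (Fin 3 → k) ⊗[k] (Fin 3 → k) →ₗ[k] (Fin 3 → k) ⊗[k] (Fin 3 → k) :=
  ((Pi.basisFun k (Fin 3)).tensorProduct (Pi.basisFun k (Fin 3))).constr k fun ij =>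
    ∑ m : Fin 3, ∑ l : Fin 3,
      R (finProdFinEquiv (m, l)) (finProdFinEquiv (ij.2, ij.1)) • (x k m ⊗ₜ[k] x k l)

/-- The `R`-matrix `ℜ_{1,3}`. -/
def R13 (a b p q t : k) : Matrix (Fin 9) (Fin 9) k :=
  !![t, 0, t*a,  0, 0, 0,    -(t*a), 0,      -(t*a*b);
     0, t, 0,    0, 0, 0,    0,      -(t*b), -(t*p);
     0, 0, t,    0, 0, 0,    0,      0,      -(t*b);
     0, 0, 0,    t, 0, t*b,  0,      0,      t*p;
     0, 0, 0,    0, t, 0,    0,      0,      t*q;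
     0, 0, 0,    0, 0, t,    0,      0,      0;
     0, 0, 0,    0, 0, 0,    t,      0,      t*b;
     0, 0, 0,    0, 0, 0,    0,      t,      0;
     0, 0, 0,    0, 0, 0,    0,      0,      t]

theorem mapOfMatrix_tmul (R : Matrix (Fin 9) (Fin 9) k) (i j : Fin 3) :
    mapOfMatrix R (x k i ⊗ₜ x k j) = ∑ m : Fin 3, ∑ l : Fin 3,
      R (finProdFinEquiv (m, l)) (finProdFinEquiv (j, i)) • (x k m ⊗ₜ[k] x k l) := by
  have := ((Pi.basisFun k (Fin 3)).tensorProduct (Pi.basisFun k (Fin 3))).constr_basis k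
    (fun ij => ∑ m : Fin 3, ∑ l : Fin 3,
      R (finProdFinEquiv (m, l)) (finProdFinEquiv (ij.2, ij.1)) • (x k m ⊗ₜ[k] x k l)) (i, j)
  rwa [Module.Basis.tensorProduct_apply, Pi.basisFun_apply, Pi.basisFun_apply] at this

theorem mapOfMatrix_R13 (a b p q t : k) :
    let c := mapOfMatrix (R13 a b p q t)
    let e := x k
    c (e 0 ⊗ₜ e 0) = t • e 0 ⊗ₜ e 0 ∧
    c (e 1 ⊗ₜ e 0) = t • e 0 ⊗ₜ e 1 ∧
    c (e 2 ⊗ₜ e 0) = t • e 0 ⊗ₜ e 2 + (t * a) • e 0 ⊗ₜ e 0 ∧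
    c (e 0 ⊗ₜ e 1) = t • e 1 ⊗ₜ e 0 ∧
    c (e 1 ⊗ₜ e 1) = t • e 1 ⊗ₜ e 1 ∧
    c (e 2 ⊗ₜ e 1) = t • e 1 ⊗ₜ e 2 + (t * b) • e 1 ⊗ₜ e 0 ∧
    c (e 0 ⊗ₜ e 2) = t • e 2 ⊗ₜ e 0 - (t * a) • e 0 ⊗ₜ e 0 ∧
    c (e 1 ⊗ₜ e 2) = t • e 2 ⊗ₜ e 1 - (t * b) • e 0 ⊗ₜ e 1 ∧
    c (e 2 ⊗ₜ e 2) = t • e 2 ⊗ₜ e 2 + (t * b) • e 2 ⊗ₜ e 0 + (t * q) • e 1 ⊗ₜ e 1 +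
      (t * p) • e 1 ⊗ₜ e 0 - (t * b) • e 0 ⊗ₜ e 2 - (t * p) • e 0 ⊗ₜ e 1 -
      (t * a * b) • e 0 ⊗ₜ e 0 := by
  have h : ∀ m l : Fin 3, (finProdFinEquiv (m, l) : Fin 9) =
      ⟨l + 3 * m, by omega⟩ := fun m l => rfl
  refine ⟨?_, ?_, ?_, ?_, ?_, ?_, ?_, ?_, ?_⟩ <;>
  · rw [mapOfMatrix_tmul]
    simp [Fin.sum_univ_three, h, R13]
    try module

set_option maxHeartbeats 2000000 in
theorem braid_aux {V : Type*} [AddCommGroup V] [Module k V] (a b p q t : k)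
    (c : V ⊗[k] V →ₗ[k] V ⊗[k] V) (e : Fin 3 → V)
    (h00 : c (e 0 ⊗ₜ e 0) = t • e 0 ⊗ₜ e 0)
    (h10 : c (e 1 ⊗ₜ e 0) = t • e 0 ⊗ₜ e 1)
    (h20 : c (e 2 ⊗ₜ e 0) = t • e 0 ⊗ₜ e 2 + (t * a) • e 0 ⊗ₜ e 0)
    (h01 : c (e 0 ⊗ₜ e 1) = t • e 1 ⊗ₜ e 0)
    (h11 : c (e 1 ⊗ₜ e 1) = t • e 1 ⊗ₜ e 1)
    (h21 : c (e 2 ⊗ₜ e 1) = t • e 1 ⊗ₜ e 2 + (t * b) • e 1 ⊗ₜ e 0)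
    (h02 : c (e 0 ⊗ₜ e 2) = t • e 2 ⊗ₜ e 0 - (t * a) • e 0 ⊗ₜ e 0)
    (h12 : c (e 1 ⊗ₜ e 2) = t • e 2 ⊗ₜ e 1 - (t * b) • e 0 ⊗ₜ e 1)
    (h22 : c (e 2 ⊗ₜ e 2) = t • e 2 ⊗ₜ e 2 + (t * b) • e 2 ⊗ₜ e 0 + (t * q) • e 1 ⊗ₜ e 1 +
      (t * p) • e 1 ⊗ₜ e 0 - (t * b) • e 0 ⊗ₜ e 2 - (t * p) • e 0 ⊗ₜ e 1 -
      (t * a * b) • e 0 ⊗ₜ e 0)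
    (c₁ c₂ : V ⊗[k] (V ⊗[k] V) →ₗ[k] V ⊗[k] (V ⊗[k] V))
    (h1 : ∀ u v w : V, c₁ (u ⊗ₜ (v ⊗ₜ w)) = TensorProduct.assoc k _ _ _ (c (u ⊗ₜ v) ⊗ₜ w))
    (h2 : ∀ u v w : V, c₂ (u ⊗ₜ (v ⊗ₜ w)) = u ⊗ₜ c (v ⊗ₜ w)) (i j l : Fin 3) :
    c₁ (c₂ (c₁ (e i ⊗ₜ (e j ⊗ₜ e l)))) = c₂ (c₁ (c₂ (e i ⊗ₜ (e j ⊗ₜ e l)))) := by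
  fin_cases i <;> fin_cases j <;> fin_cases l <;>
  · simp only [Fin.zero_eta, Fin.mk_one, Fin.reduceFinMk, h1, h2, h00, h10, h20, h01, h11, h21,
      h02, h12, h22, TensorProduct.add_tmul, TensorProduct.tmul_add, TensorProduct.sub_tmul,
      TensorProduct.tmul_sub, map_add, map_sub, map_smul, TensorProduct.tmul_smul,
      ← TensorProduct.smul_tmul', TensorProduct.assoc_tmul]
    try module

/-- The braiding of `V = k³` associated to `ℜ_{1,3}`. -/
noncomputable def braiding13 (a b p q t : k) (ht : t ≠ 0) : Braiding k (Fin 3 → k) where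
  toMap := mapOfMatrix (R13 a b p q t)
  bijective := by
    obtain ⟨h00, h10, h20, h01, h11, h21, h02, h12, h22⟩ := mapOfMatrix_R13 a b p q t
    set c := mapOfMatrix (R13 a b p q t)
    set r := LinearMap.range c with hr
    have key : ∀ u w, c u = t • w → w ∈ r := fun u w h =>
      ⟨t⁻¹ • u, by rw [map_smul, h, smul_smul, inv_mul_cancel₀ ht, one_smul]⟩
    have hc : ∀ u, c u ∈ r := fun u => ⟨u, rfl⟩
    have k00 := key _ _ h00
    have k01 := key _ _ h10
    have k10 := key _ _ h01
    have k11 := key _ _ h11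
    have key' : ∀ w, t • w ∈ r → w ∈ r := fun w h => by
      simpa [smul_smul, inv_mul_cancel₀ ht] using r.smul_mem t⁻¹ h
    have k02 : x k 0 ⊗ₜ[k] x k 2 ∈ r := key' _ <| by
      have := r.sub_mem (hc (x k 2 ⊗ₜ x k 0)) (r.smul_mem (t * a) k00)
      rw [h20] at this; convert this using 1; module
    have k12 : x k 1 ⊗ₜ[k] x k 2 ∈ r := key' _ <| by
      have := r.sub_mem (hc (x k 2 ⊗ₜ x k 1)) (r.smul_mem (t * b) k10)
      rw [h21] at this; convert this using 1; module
    have k20 : x k 2 ⊗ₜ[k] x k 0 ∈ r := key' _ <| by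
      have := r.add_mem (hc (x k 0 ⊗ₜ x k 2)) (r.smul_mem (t * a) k00)
      rw [h02] at this; convert this using 1; module
    have k21 : x k 2 ⊗ₜ[k] x k 1 ∈ r := key' _ <| by
      have := r.add_mem (hc (x k 1 ⊗ₜ x k 2)) (r.smul_mem (t * b) k01)
      rw [h12] at this; convert this using 1; module
    have k22 : x k 2 ⊗ₜ[k] x k 2 ∈ r := key' _ <| by
      have := r.add_mem (hc (x k 2 ⊗ₜ x k 2)) (r.add_mem (r.smul_mem (-(t * b)) k20)
        (r.add_mem (r.smul_mem (-(t * q)) k11) (r.add_mem (r.smul_mem (-(t * p)) k10)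
        (r.add_mem (r.smul_mem (t * b) k02) (r.add_mem (r.smul_mem (t * p) k01)
        (r.smul_mem (t * a * b) k00))))))
      rw [h22] at this; convert this using 1; module
    have hs : Function.Surjective c := by
      rw [← LinearMap.range_eq_top, ← hr, eq_top_iff,
        ← ((Pi.basisFun k (Fin 3)).tensorProduct (Pi.basisFun k (Fin 3))).span_eq,
        Submodule.span_le]
      rintro _ ⟨⟨i, j⟩, rfl⟩
      rw [Module.Basis.tensorProduct_apply, Pi.basisFun_apply, Pi.basisFun_apply]
      change x k i ⊗ₜ[k] x k j ∈ r
      fin_cases i <;> fin_cases j <;> assumption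
    exact ⟨LinearMap.injective_iff_surjective.mpr hs, hs⟩
  braid_eq := by
    intro c₁ c₂
    obtain ⟨h00, h10, h20, h01, h11, h21, h02, h12, h22⟩ := mapOfMatrix_R13 a b p q t
    refine ((Pi.basisFun k (Fin 3)).tensorProduct
      ((Pi.basisFun k (Fin 3)).tensorProduct (Pi.basisFun k (Fin 3)))).ext ?_
    rintro ⟨i, j, l⟩
    have h1 : ∀ u v w : Fin 3 → k, c₁ (u ⊗ₜ (v ⊗ₜ w)) = TensorProduct.assoc k _ _ _
      (mapOfMatrix (R13 a b p q t) (u ⊗ₜ v) ⊗ₜ w) := fun u v w => rfl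
    have h2 : ∀ u v w : Fin 3 → k, c₂ (u ⊗ₜ (v ⊗ₜ w)) =
      u ⊗ₜ mapOfMatrix (R13 a b p q t) (v ⊗ₜ w) := fun u v w => rfl
    simp only [Module.Basis.tensorProduct_apply, Pi.basisFun_apply, Module.End.mul_apply]
    exact braid_aux a b p q t _ (x k) h00 h10 h20 h01 h11 h21 h02 h12 h22 c₁ c₂ h1 h2 i j l


/-- The generators `x_1, x_2, x_3` of the tensor algebra `T(V)`. -/
def X (k : Type*) [Field k] (i : Fin 3) : TensorAlgebra k (Fin 3 → k) := TensorAlgebra.ι k (x k i)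

/-- The monomial `x_1^{a_1} x_2^{a_2} x_3^{a_3}` in `𝔅(V)`. -/
noncomputable def monomial (c : Braiding k (Fin 3 → k)) (e : ℕ × ℕ × ℕ) : NicholsAlgebra c :=
  NicholsAlgebra.ι c (x k 0) ^ e.1 * NicholsAlgebra.ι c (x k 1) ^ e.2.1 *
    NicholsAlgebra.ι c (x k 2) ^ e.2.2

/-- The monomials with exponents `(a_1, a_2, a_3)` in `S` form a basis of `𝔅(V)`. -/
def IsMonomialBasis (c : Braiding k (Fin 3 → k)) (S : Set (ℕ × ℕ × ℕ)) : Prop :=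
  LinearIndependent k (fun e : S => monomial c e.1) ∧
    Submodule.span k (Set.range fun e : S => monomial c e.1) = ⊤

end RankThree

/-- The exponents of the monomials in `B_0`. -/
def B0 : Set (ℕ × ℕ × ℕ) := {e | e.1 < 2 ∧ e.2.1 < 2 ∧ e.2.2 < 2}

/-- The exponents of the monomials in `B_1`. -/
def B1 : Set (ℕ × ℕ × ℕ) := {e | e.1 < 2 ∧ e.2.1 < 2}

/-- The exponents of the monomials in `B_3`. -/
def B3 : Set (ℕ × ℕ × ℕ) := Set.univ

end Nichols

open Nichols

/-! The quantum symmetrizers are studied through skew derivations. A permutation of `n + 1` points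
is a shuffle of one point to the front followed by a permutation of the other `n`, so `Q_{n+1} = (id
⊗ Q_n) S_{n+1}` with `S_{n+1} = 1 + c_0 + c_0 c_1 + ⋯`. Writing `S_{n+1} u = ∑ x_m ⊗ ∂_m u` defines
linear maps `∂_m` on `T(V)` satisfying `∂_m (x_j w) = δ_{mj} w + ∑ C j i m l • x_l ∂_i w`, where `C`
holds the coefficients of the braiding. Hence `u` is a relation of degree `n + 1` exactly when every
`∂_m u` is a relation of degree `n` (`mem_relations_succ`).

Let `R` be a set of quadratic elements and `A = T(V)/⟨R⟩`. If the `∂_m` descend to maps `D_m` on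
`A`, and if only scalars are killed by all `D_m`, then induction on the degree gives `J(V) = ⟨R⟩`
(`definingIdeal_eq_span`). To see that they descend, `T(V)` acts on `A × A³` by operators encoding
the product rule, and these operators are checked to satisfy `R`.

The last condition follows from functionals that are triangular on ordered monomials and vanish on
the constants of the `D_m` (`HasTriangularFunctionals`); these also make the monomials independent.
For `t = 1` they are `ε D_0^i D_1^j D_2^n`, with `D_2^n (y_2^n) = n!`. For `t = -1` one has `D_2² =
0`, and the powers of `y_2` are detected by `D_1²`: `(D_1²)^n (y_2^{2n}) = (-q)^n n!`. Thus for `q ≠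
0` all powers of `y_2` survive, while for `q = 0` there is a relation for `y_2²`. Straightening
(`IsStraightening`) shows that ordered monomials span, compatibly with the degree filtration, so the
growth is a count of exponents.

For `t² ≠ 1`, a quadratic relation is an element killed by `1 + c`, and `1 + c` is injective by
solving a triangular linear system. -/

namespace Nichols

/-! ### Skew derivations -/

section SkewDerivation

variable {k ι : Type*} [Field k] [Fintype ι] [DecidableEq ι]

/-- Left multiplication by `y j` on `A`, together with the induced rule for skew derivations. -/
def skewOp {A : Type*} [Ring A] [Algebra k A] (C : ι → ι → ι → ι → k) (y : ι → A) (j : ι) :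
    Module.End k (A × (ι → A)) where
  toFun f := (y j * f.1,
    fun m => (if m = j then f.1 else 0) + ∑ i, ∑ l, C j i m l • (y l * f.2 i))
  map_add' f g := by
    refine Prod.ext (mul_add _ _ _) (funext fun m => ?_)
    simp only [Prod.fst_add, Prod.snd_add, Pi.add_apply, mul_add, smul_add,
      Finset.sum_add_distrib]
    split_ifs <;> abel
  map_smul' r f := by
    refine Prod.ext (by simp) (funext fun m => ?_)
    simp only [Prod.smul_fst, Prod.smul_snd, Pi.smul_apply, mul_smul_comm, RingHom.id_apply,
      smul_add, Finset.smul_sum, smul_comm r]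
    split_ifs <;> simp

variable {V : Type*} [AddCommGroup V] [Module k V]

/-- The action of the tensor algebra on `A × (ι → A)` by the operators `skewOp C y j`. -/
noncomputable def skewRep {A : Type*} [Ring A] [Algebra k A] (e : Module.Basis ι k V)
    (C : ι → ι → ι → ι → k) (y : ι → A) :
    TensorAlgebra k V →ₐ[k] Module.End k (A × (ι → A)) :=
  TensorAlgebra.lift k (e.constr k (skewOp C y))

@[simp]
theorem skewRep_ι {A : Type*} [Ring A] [Algebra k A] (e : Module.Basis ι k V)
    (C : ι → ι → ι → ι → k) (y : ι → A) (j : ι) :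
    skewRep e C y (TensorAlgebra.ι k (e j)) = skewOp C y j := by
  simp [skewRep]

variable (k) in
/-- Evaluation of an endomorphism of `A × (ι → A)` at `(1, 0)`, followed by a coordinate. -/
def evalOne {ι : Type*} (A : Type*) [Ring A] [Algebra k A] (m : ι) :
    Module.End k (A × (ι → A)) →ₗ[k] A :=
  LinearMap.proj m ∘ₗ LinearMap.snd k A (ι → A) ∘ₗ LinearMap.applyₗ (1, 0)

@[simp]
theorem evalOne_apply {ι : Type*} (A : Type*) [Ring A] [Algebra k A] (m : ι)
    (f : Module.End k (A × (ι → A))) : evalOne k A m f = (f (1, 0)).2 m := rfl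

/-- The skew derivations of the tensor algebra attached to the coefficients of a braiding. -/
noncomputable def skewDeriv (e : Module.Basis ι k V) (C : ι → ι → ι → ι → k) (m : ι) :
    TensorAlgebra k V →ₗ[k] TensorAlgebra k V :=
  evalOne k _ m ∘ₗ (skewRep e C fun j => TensorAlgebra.ι k (e j)).toLinearMap

/-- The product rule of a skew derivation concerns left multiplication by one generator only, and
this induction matches it. A subspace stable under left multiplication by the generators is a left
ideal, and it contains `1`. -/
theorem ι_mul_induction {ι : Type*} [Fintype ι] (e : Module.Basis ι k V)
    {p : TensorAlgebra k V → Prop}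
    (one : p 1) (ι_mul : ∀ j w, p w → p (TensorAlgebra.ι k (e j) * w))
    (add : ∀ u v, p u → p v → p (u + v)) (smul : ∀ (r : k) u, p u → p (r • u)) (w) : p w := by
  let N : Submodule k (TensorAlgebra k V) :=
    { carrier := {w | p w}
      add_mem' := fun hu hv => add _ _ hu hv
      zero_mem' := by simpa using smul 0 1 one
      smul_mem' := fun r u hu => smul r u hu }
  have h : ∀ u : TensorAlgebra k V, ∀ w ∈ N, u * w ∈ N := by
    intro u
    induction u using TensorAlgebra.induction with
    | algebraMap r =>
      intro w hw
      rw [← Algebra.smul_def]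
      exact N.smul_mem r hw
    | ι v =>
      intro w hw
      rw [← e.sum_repr v, map_sum, Finset.sum_mul]
      refine N.sum_mem fun j _ => ?_
      rw [map_smul, smul_mul_assoc]
      exact N.smul_mem _ (ι_mul j w hw)
    | mul u v hu hv =>
      intro w hw
      rw [mul_assoc]
      exact hu _ (hv _ hw)
    | add u v hu hv =>
      intro w hw
      rw [add_mul]
      exact N.add_mem (hu _ hw) (hv _ hw)
  have h1 : w * 1 ∈ N := h w 1 one
  rwa [mul_one] at h1

/-- Applying `w` to `(1, 0)` yields the image of `w` together with all its skew derivatives.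
Identifying the first entry turns the second entry of `skewOp` into the product rule. -/
theorem skewRep_apply_fst {A : Type*} [Ring A] [Algebra k A] (e : Module.Basis ι k V)
    (C : ι → ι → ι → ι → k) (y : ι → A) (π : TensorAlgebra k V →ₐ[k] A)
    (hπ : ∀ j, π (TensorAlgebra.ι k (e j)) = y j) (w : TensorAlgebra k V) :
    (skewRep e C y w (1, 0)).1 = π w := by
  induction w using ι_mul_induction e with
  | one => simp
  | ι_mul j w hw => simp [Module.End.mul_apply, skewOp, hw, hπ]
  | add u v hu hv => simp [hu, hv]
  | smul r u hu => simp [hu]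

@[simp]
theorem skewDeriv_one (e : Module.Basis ι k V) (C : ι → ι → ι → ι → k) (m : ι) :
    skewDeriv e C m 1 = 0 := by
  simp [skewDeriv]

theorem skewDeriv_ι_mul (e : Module.Basis ι k V) (C : ι → ι → ι → ι → k) (m j : ι)
    (w : TensorAlgebra k V) :
    skewDeriv e C m (TensorAlgebra.ι k (e j) * w) = (if m = j then w else 0) +
      ∑ i, ∑ l, C j i m l • (TensorAlgebra.ι k (e l) * skewDeriv e C i w) := by
  have h := skewRep_apply_fst e C (fun j => TensorAlgebra.ι k (e j)) (AlgHom.id k _)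
    (fun _ => rfl) w
  simp only [AlgHom.coe_id, id_eq] at h
  simp [skewDeriv, Module.End.mul_apply, skewOp, h]

/-- For zero braiding coefficients, the skew derivation of index `j` strips a leading letter `e j`
and kills the words with another first letter. -/
theorem eq_zero_of_sum_ι_mul_eq_zero (e : Module.Basis ι k V) (a : ι → TensorAlgebra k V)
    (h : ∑ j, TensorAlgebra.ι k (e j) * a j = 0) (j : ι) : a j = 0 := by
  have := congrArg (skewDeriv e (fun _ _ _ _ => 0) j) h
  simpa [skewDeriv_ι_mul] using this

end SkewDerivation

/-! ### Quantum symmetrizers inside the tensor algebra -/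

section QuantumSymmetrizer

variable {k V : Type*} [Field k] [AddCommGroup V] [Module k V]

open TensorPower hiding mul_assoc one_mul mul_one cast

/-- Identities between tensors of different shapes can therefore be verified in `T(V)`, where the
casts between tensor powers disappear. -/
theorem toTensorAlgebra_injective (n : ℕ) :
    Function.Injective (toTensorAlgebra : ⨂[k]^n V →ₗ[k] TensorAlgebra k V) := by
  have h : ∀ u : ⨂[k]^n V,
      TensorAlgebra.ofDirectSum (DirectSum.of (fun n => ⨂[k]^n V) n u) = toTensorAlgebra u :=
    fun u => DirectSum.toAddMonoid_of
      (fun _ => LinearMap.toAddMonoidHom TensorPower.toTensorAlgebra) _ _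
  intro u v huv
  rw [← h, ← h] at huv
  exact DirectSum.of_injective n (TensorAlgebra.equivDirectSum.symm.injective huv)

@[simp]
theorem toTensorAlgebra_cast {n m : ℕ} (h : n = m) (u : ⨂[k]^n V) :
    toTensorAlgebra (TensorPower.cast k V h u) = toTensorAlgebra u := by
  subst h; simp

@[simp]
theorem toTensorAlgebra_mulEquiv {i j : ℕ} (a : ⨂[k]^i V) (b : ⨂[k]^j V) :
    toTensorAlgebra (mulEquiv (a ⊗ₜ[k] b)) = toTensorAlgebra a * toTensorAlgebra b :=
  toTensorAlgebra_gMul a b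

variable (k V) in
/-- The multiplication `V ⊗ V → T(V)`. -/
noncomputable def pairMul : V ⊗[k] V →ₗ[k] TensorAlgebra k V :=
  LinearMap.mul' k _ ∘ₗ TensorProduct.map (TensorAlgebra.ι k) (TensorAlgebra.ι k)

@[simp]
theorem pairMul_tmul (v w : V) :
    pairMul k V (v ⊗ₜ w) = TensorAlgebra.ι k v * TensorAlgebra.ι k w := by
  simp [pairMul]

theorem toTensorAlgebra_pairEquiv (z : V ⊗[k] V) :
    toTensorAlgebra (pairEquiv k V z) = pairMul k V z := by
  induction z using TensorProduct.induction_on with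
  | zero => simp
  | add z w hz hw => simp [hz, hw]
  | tmul v w =>
    simp only [pairEquiv, LinearEquiv.trans_apply, TensorProduct.congr_tmul, pairMul_tmul]
    refine (toTensorAlgebra_mulEquiv _ _).trans ?_
    simp [TensorAlgebra.tprod_apply]

/-- Prepending a vector to a tensor. -/
noncomputable def consTensor (n : ℕ) (v : V) : ⨂[k]^n V →ₗ[k] ⨂[k]^(n + 1) V :=
  (TensorPower.cast k V (add_comm 1 n)).toLinearMap ∘ₗ mulEquiv.toLinearMap ∘ₗ
    TensorProduct.mk k _ _ ((PiTensorProduct.subsingletonEquiv (0 : Fin 1)).symm v)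

@[simp]
theorem toTensorAlgebra_consTensor (n : ℕ) (v : V) (u : ⨂[k]^n V) :
    toTensorAlgebra (consTensor n v u) = TensorAlgebra.ι k v * toTensorAlgebra u := by
  simp [consTensor, TensorAlgebra.tprod_apply]

/-- The working description of the braid generators: in a product `a · z · b` in `T(V)`, only the
quadratic factor `z` changes. -/
theorem toTensorAlgebra_braidGenerator (c : Braiding k V) {n i j : ℕ} (h : i + 2 + j = n)
    (u : ⨂[k]^n V) (a : ⨂[k]^i V) (z : V ⊗[k] V) (b : ⨂[k]^j V)
    (hu : toTensorAlgebra u = toTensorAlgebra a * pairMul k V z * toTensorAlgebra b) :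
    toTensorAlgebra (braidGenerator c n i u) =
      toTensorAlgebra a * pairMul k V (c.toMap z) * toTensorAlgebra b := by
  subst h
  obtain rfl : u = mulEquiv (mulEquiv (a ⊗ₜ pairEquiv k V z) ⊗ₜ b) := by
    apply toTensorAlgebra_injective
    simp [hu, toTensorAlgebra_pairEquiv]
  -- The definition uses `n - (i + 2)` factors on the right, which equals `j` only propositionally;
  -- a free `l` makes the substitution possible.
  have key : ∀ (l : ℕ) (h : i + 2 + l = i + 2 + j),
      toTensorAlgebra ((TensorPower.cast k V h).conj (applyAt c.toMap i l)
        (mulEquiv (mulEquiv (a ⊗ₜ pairEquiv k V z) ⊗ₜ b))) =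
      toTensorAlgebra a * pairMul k V (c.toMap z) * toTensorAlgebra b := by
    intro l h
    obtain rfl : l = j := by omega
    simp [applyAt, LinearEquiv.conj_apply, toTensorAlgebra_pairEquiv]
  rw [braidGenerator, dif_pos (by omega)]
  exact key _ _

theorem toTensorAlgebra_zero (u : ⨂[k]^0 V) :
    ∃ r : k, toTensorAlgebra u = algebraMap k (TensorAlgebra k V) r := by
  obtain ⟨r, rfl⟩ := (algebraMap₀ (R := k) (M := V)).surjective u
  exact ⟨r, by rw [algebraMap₀_eq_smul_one, map_smul, toTensorAlgebra_gOne,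
    Algebra.algebraMap_eq_smul_one]⟩

theorem consTensor_induction {ι : Type*} [Fintype ι] (e : Module.Basis ι k V) {n : ℕ}
    {p : ⨂[k]^(n + 1) V → Prop} (zero : p 0) (cons : ∀ j w, p (consTensor n (e j) w))
    (add : ∀ u v, p u → p v → p (u + v)) (smul : ∀ (r : k) u, p u → p (r • u)) (u) : p u := by
  let N : Submodule k (⨂[k]^(n + 1) V) :=
    { carrier := {w | p w}
      add_mem' := fun hu hv => add _ _ hu hv
      zero_mem' := zero
      smul_mem' := fun r u hu => smul r u hu }
  have : (⊤ : Submodule k (⨂[k]^(n + 1) V)) ≤ N := by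
    rw [← PiTensorProduct.span_tprod_eq_top, Submodule.span_le]
    rintro _ ⟨f, rfl⟩
    have h : PiTensorProduct.tprod k f = ∑ j, e.repr (f 0) j •
        consTensor n (e j) (PiTensorProduct.tprod k fun i => f i.succ) := by
      apply toTensorAlgebra_injective
      simp only [map_sum, map_smul, toTensorAlgebra_consTensor, ← smul_mul_assoc,
        ← Finset.sum_mul]
      simp only [← map_smul, ← map_sum, e.sum_repr]
      simp [TensorAlgebra.tprod_apply, List.ofFn_succ]
    rw [h]
    exact N.sum_mem fun j _ => N.smul_mem _ (cons j _)
  exact this trivial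

/-- Every tensor is a sum of products that isolate the two factors on which the braid generator
acts. -/
theorem mul_pairMul_mul_induction {n i j : ℕ} (h : i + 2 + j = n) {p : ⨂[k]^n V → Prop}
    (zero : p 0) (add : ∀ u v, p u → p v → p (u + v))
    (mul : ∀ (u : ⨂[k]^n V) (a : ⨂[k]^i V) z (b : ⨂[k]^j V),
      toTensorAlgebra u = toTensorAlgebra a * pairMul k V z * toTensorAlgebra b → p u)
    (u) : p u := by
  subst h
  obtain ⟨w, rfl⟩ := (mulEquiv (R := k) (M := V) (n := i + 2) (m := j)).surjective u
  induction w using TensorProduct.induction_on with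
  | zero => simpa using zero
  | add u v hu hv => rw [map_add]; exact add _ _ hu hv
  | tmul u b =>
    obtain ⟨w, rfl⟩ := (mulEquiv (R := k) (M := V) (n := i) (m := 2)).surjective u
    induction w using TensorProduct.induction_on with
    | zero => simpa using zero
    | add u v hu hv => rw [map_add, TensorProduct.add_tmul, map_add]; exact add _ _ hu hv
    | tmul a z =>
      obtain ⟨z, rfl⟩ := (pairEquiv k V).surjective z
      exact mul _ a z b (by simp [toTensorAlgebra_pairEquiv])

theorem braidGenerator_succ_consTensor (c : Braiding k V) {n i : ℕ} (hi : i + 1 < n) (v : V)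
    (u : ⨂[k]^n V) :
    braidGenerator c (n + 1) (i + 1) (consTensor n v u) =
      consTensor n v (braidGenerator c n i u) := by
  obtain ⟨j, hj⟩ : ∃ j, i + 2 + j = n := ⟨n - (i + 2), by omega⟩
  induction u using mul_pairMul_mul_induction hj with
  | zero => simp
  | add u w hu hw => simp [hu, hw]
  | mul u a z b h =>
    apply toTensorAlgebra_injective
    rw [toTensorAlgebra_consTensor, toTensorAlgebra_braidGenerator c hj u a z b h,
      toTensorAlgebra_braidGenerator c (j := j) (by omega) _ (consTensor i v a) z b (by
        simp [h, mul_assoc])]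
    simp [mul_assoc]

theorem prod_braidGenerator_succ_consTensor (c : Braiding k V) {n : ℕ} (v : V) (w : List ℕ)
    (hw : ∀ i ∈ w, i + 1 < n) (u : ⨂[k]^n V) :
    ((w.map Nat.succ).map (braidGenerator c (n + 1))).prod (consTensor n v u) =
      consTensor n v ((w.map (braidGenerator c n)).prod u) := by
  induction w with
  | nil => simp
  | cons i w ih =>
    simp only [List.map_cons, List.prod_cons, Module.End.mul_apply]
    rw [ih fun i hi => hw i (List.mem_cons_of_mem _ hi)]
    exact braidGenerator_succ_consTensor c (hw i List.mem_cons_self) v _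

theorem toTensorAlgebra_braidGenerator_zero (c : Braiding k V) {n : ℕ} (v w : V) (u : ⨂[k]^n V) :
    toTensorAlgebra (braidGenerator c (n + 2) 0 (consTensor (n + 1) v (consTensor n w u))) =
      pairMul k V (c.toMap (v ⊗ₜ w)) * toTensorAlgebra u := by
  rw [toTensorAlgebra_braidGenerator c (i := 0) (j := n) (by omega) _
    (algebraMap₀ 1) (v ⊗ₜ w) u (by simp [algebraMap₀_one, mul_assoc])]
  simp [algebraMap₀_one]

/-- The sum `1 + c_0 + c_0 c_1 + ⋯ + c_0 ⋯ c_{n-2}` over the shuffles of one factor to the left. -/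
noncomputable def shuffleSum (c : Braiding k V) (n : ℕ) : Module.End k (⨂[k]^n V) :=
  ∑ j ∈ Finset.range n, ((List.range j).map (braidGenerator c n)).prod

/-- The word `0, 1, …, j` is `0` followed by the shift of `0, …, j - 1`, and shifted generators do
not touch the first factor: `S_{n+1} = 1 + c_0 (id ⊗ S_n)`. -/
theorem shuffleSum_consTensor (c : Braiding k V) (n : ℕ) (v : V) (u : ⨂[k]^n V) :
    shuffleSum c (n + 1) (consTensor n v u) = consTensor n v u +
      braidGenerator c (n + 1) 0 (consTensor n v (shuffleSum c n u)) := by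
  rw [shuffleSum, Finset.sum_range_succ', LinearMap.add_apply, add_comm (consTensor n v u), shuffleSum,
    LinearMap.sum_apply, LinearMap.sum_apply, map_sum, map_sum]
  congr 1
  refine Finset.sum_congr rfl fun j hj => ?_
  rw [List.range_succ_eq_map, List.map_cons, List.prod_cons, Module.End.mul_apply,
    prod_braidGenerator_succ_consTensor]
  intro i hi
  simp only [List.mem_range, Finset.mem_range] at hi hj
  omega

/-- A permutation is the product of its reduced word, which depends on this pair only; the
cardinalities agree since `(n + 1)! = (n + 1) · n!`. -/
theorem removeAt_bijective (n : ℕ) :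
    Function.Bijective fun σ : Equiv.Perm (Fin (n + 1)) =>
      (σ.symm 0, removeAt σ (σ.symm 0)) := by
  rw [Fintype.bijective_iff_injective_and_card]
  refine ⟨fun σ τ h => ?_, by simp [Fintype.card_perm, Nat.factorial_succ]⟩
  simp only [Prod.mk.injEq] at h
  rw [← prod_reducedWord _ σ, ← prod_reducedWord _ τ, reducedWord, reducedWord, h.2, h.1]

/-- The reduced word of a permutation is a shifted word for the smaller permutation followed by
`List.range j`, and the two parts vary independently, so the sum factors. -/
theorem quantumSymmetrizer_succ (c : Braiding k V) (n : ℕ) :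
    quantumSymmetrizer c (n + 1) = (∑ σ : Equiv.Perm (Fin n),
      (((reducedWord n σ).map Nat.succ).map (braidGenerator c (n + 1))).prod) *
        shuffleSum c (n + 1) := by
  rw [shuffleSum, ← Fin.sum_univ_eq_sum_range
    (fun j => ((List.range j).map (braidGenerator c (n + 1))).prod), Finset.sum_mul_sum,
    Finset.sum_comm, ← Fintype.sum_prod_type', ← (removeAt_bijective n).sum_comp,
    quantumSymmetrizer]
  simp [reducedWord]

theorem quantumSymmetrizer_succ_of_shuffleSum {ι : Type*} [Fintype ι] (c : Braiding k V) (n : ℕ)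
    (e : ι → V) (u : ⨂[k]^(n + 1) V) (w : ι → ⨂[k]^n V)
    (h : shuffleSum c (n + 1) u = ∑ m, consTensor n (e m) (w m)) :
    quantumSymmetrizer c (n + 1) u = ∑ m, consTensor n (e m) (quantumSymmetrizer c n (w m)) := by
  rw [quantumSymmetrizer_succ, Module.End.mul_apply, h, map_sum]
  refine Finset.sum_congr rfl fun m _ => ?_
  rw [LinearMap.sum_apply, quantumSymmetrizer, LinearMap.sum_apply, map_sum]
  exact Finset.sum_congr rfl fun σ _ =>
    prod_braidGenerator_succ_consTensor c _ _ (reducedWord_lt n σ) _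

variable {ι : Type*} [Fintype ι] [DecidableEq ι] (c : Braiding k V) (e : Module.Basis ι k V)
  {C : ι → ι → ι → ι → k}

/-- The components of the shuffle sum along a basis are the skew derivatives: prepending a letter
changes both by the same recursion, by `shuffleSum_consTensor` and `skewDeriv_ι_mul`. -/
theorem exists_shuffleSum_eq
    (hC : ∀ i j, c.toMap (e i ⊗ₜ e j) = ∑ m, ∑ l, C i j m l • (e m ⊗ₜ[k] e l)) (n : ℕ)
    (u : ⨂[k]^(n + 1) V) : ∃ w : ι → ⨂[k]^n V,
      shuffleSum c (n + 1) u = ∑ m, consTensor n (e m) (w m) ∧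
      ∀ m, toTensorAlgebra (w m) = skewDeriv e C m (toTensorAlgebra u) := by
  induction n with
  | zero =>
    induction u using consTensor_induction e with
    | zero => exact ⟨0, by simp, by simp⟩
    | add u v hu hv =>
      obtain ⟨w, hw, hw'⟩ := hu
      obtain ⟨w₁, hw₁, hw₁'⟩ := hv
      exact ⟨w + w₁, by simp [hw, hw₁, Finset.sum_add_distrib], by simp [hw', hw₁']⟩
    | smul r u hu =>
      obtain ⟨w, hw, hw'⟩ := hu
      exact ⟨r • w, by simp [hw, Finset.smul_sum], by simp [hw']⟩
    | cons j u =>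
      refine ⟨fun m => if m = j then u else 0, ?_, fun m => ?_⟩
      · rw [Finset.sum_eq_single j (by intro m _ hm; simp [hm]) (by simp)]
        simp [shuffleSum]
      · obtain ⟨r, hr⟩ := toTensorAlgebra_zero u
        rw [toTensorAlgebra_consTensor, skewDeriv_ι_mul, hr, Algebra.algebraMap_eq_smul_one]
        split_ifs with hm <;> simp [hm, hr, Algebra.algebraMap_eq_smul_one]
  | succ n ih =>
    induction u using consTensor_induction e with
    | zero => exact ⟨0, by simp, by simp⟩
    | add u v hu hv =>
      obtain ⟨w, hw, hw'⟩ := hu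
      obtain ⟨w₁, hw₁, hw₁'⟩ := hv
      exact ⟨w + w₁, by simp [hw, hw₁, Finset.sum_add_distrib], by simp [hw', hw₁']⟩
    | smul r u hu =>
      obtain ⟨w, hw, hw'⟩ := hu
      exact ⟨r • w, by simp [hw, Finset.smul_sum], by simp [hw']⟩
    | cons j u =>
      obtain ⟨w, hw, hw'⟩ := ih u
      refine ⟨fun m => (if m = j then u else 0) +
        ∑ i, ∑ l, C j i m l • consTensor n (e l) (w i), ?_, fun m => ?_⟩
      · rw [shuffleSum_consTensor, hw]
        simp only [map_add, Finset.sum_add_distrib]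
        congr 1
        · rw [Finset.sum_eq_single j (by intro m _ hm; simp [hm]) (by simp)]
          simp
        · apply toTensorAlgebra_injective
          simp only [map_sum, toTensorAlgebra_braidGenerator_zero, hC, map_smul, pairMul_tmul,
            toTensorAlgebra_consTensor, Finset.sum_mul, smul_mul_assoc, mul_assoc]
          rw [Finset.sum_comm]
      · rw [toTensorAlgebra_consTensor, skewDeriv_ι_mul]
        simp only [map_add, map_sum, map_smul, toTensorAlgebra_consTensor, hw']
        split_ifs with hm <;> simp [hm]

@[simp]
theorem relations_zero : relations c 0 = ⊥ := by
  have : quantumSymmetrizer c 0 = 1 := by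
    rw [quantumSymmetrizer, Fintype.sum_unique]
    rfl
  rw [relations, this, Module.End.one_eq_id, LinearMap.ker_id, Submodule.map_bot]

theorem mem_relations {n : ℕ} (u : ⨂[k]^n V) :
    toTensorAlgebra u ∈ relations c n ↔ quantumSymmetrizer c n u = 0 := by
  rw [relations, Submodule.mem_map]
  exact ⟨fun ⟨v, hv, h⟩ => toTensorAlgebra_injective n h ▸ hv, fun h => ⟨u, h, rfl⟩⟩

/-- Here `Q_{n+1} u = ∑ x_m ⊗ Q_n (∂_m u)`, and the sum of the right ideals `x_m T(V)` is direct. -/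
theorem mem_relations_succ
    (hC : ∀ i j, c.toMap (e i ⊗ₜ e j) = ∑ m, ∑ l, C i j m l • (e m ⊗ₜ[k] e l)) {n : ℕ}
    (u : ⨂[k]^(n + 1) V) : toTensorAlgebra u ∈ relations c (n + 1) ↔
      ∀ m, skewDeriv e C m (toTensorAlgebra u) ∈ relations c n := by
  obtain ⟨w, hw, hw'⟩ := exists_shuffleSum_eq c e hC n u
  simp only [← hw', mem_relations]
  rw [quantumSymmetrizer_succ_of_shuffleSum c n e u w hw]
  refine ⟨fun h m => ?_, fun h => by simp [h]⟩
  apply toTensorAlgebra_injective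
  rw [map_zero]
  refine eq_zero_of_sum_ι_mul_eq_zero e
    (fun m => toTensorAlgebra (quantumSymmetrizer c n (w m))) ?_ m
  simpa using congrArg toTensorAlgebra h

theorem skewDeriv_mem_range
    (hC : ∀ i j, c.toMap (e i ⊗ₜ e j) = ∑ m, ∑ l, C i j m l • (e m ⊗ₜ[k] e l)) {n : ℕ}
    (u : ⨂[k]^(n + 1) V) (m : ι) :
    ∃ w : ⨂[k]^n V, skewDeriv e C m (toTensorAlgebra u) = toTensorAlgebra w := by
  obtain ⟨w, -, hw⟩ := exists_shuffleSum_eq c e hC n u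
  exact ⟨w m, (hw m).symm⟩

end QuantumSymmetrizer

/-! ### Nichols algebras from skew derivations of a quotient of the tensor algebra -/

section Presentation

variable {k V : Type*} [Field k] [AddCommGroup V] [Module k V]

/-- The algebra `T(V) / ⟨R⟩`. -/
abbrev Presented (R : Set (TensorAlgebra k V)) : Type _ :=
  RingQuot fun x y : TensorAlgebra k V => x ∈ R ∧ y = 0

-- The kernel is found by comparing the `RingQuot` with the quotient by the two-sided ideal, which
-- receives a map from it.
variable (k) in
theorem mkAlgHom_eq_zero_iff (R : Set (TensorAlgebra k V)) (w : TensorAlgebra k V) :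
    RingQuot.mkAlgHom k (fun x y : TensorAlgebra k V => x ∈ R ∧ y = 0) w = 0 ↔
      w ∈ TwoSidedIdeal.span R := by
  constructor
  · intro h
    let f : RingQuot (fun x y : TensorAlgebra k V => x ∈ R ∧ y = 0) →+*
        (TwoSidedIdeal.span R).ringCon.Quotient :=
      RingQuot.lift ⟨(TwoSidedIdeal.span R).ringCon.mk', fun x y ⟨hx, hy⟩ => by
        rw [hy, map_zero, ← TwoSidedIdeal.mem_ker, TwoSidedIdeal.ker_ringCon_mk']
        exact TwoSidedIdeal.subset_span hx⟩
    have hf : f (RingQuot.mkRingHom _ w) = (TwoSidedIdeal.span R).ringCon.mk' w :=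
      RingQuot.lift_mkRingHom_apply _ _ _
    rw [← RingQuot.mkAlgHom_coe k, RingHom.coe_coe, h, map_zero] at hf
    rw [← TwoSidedIdeal.ker_ringCon_mk' (TwoSidedIdeal.span R), TwoSidedIdeal.mem_ker, ← hf]
  · intro h
    rw [← TwoSidedIdeal.mem_ker]
    refine TwoSidedIdeal.span_le.2 (fun r hr => ?_) h
    rw [SetLike.mem_coe, TwoSidedIdeal.mem_ker]
    simpa using RingQuot.mkAlgHom_rel k
      (s := fun x y : TensorAlgebra k V => x ∈ R ∧ y = 0) ⟨hr, rfl⟩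

theorem homogeneous_induction {p : TensorAlgebra k V → Prop}
    (zero : p 0) (add : ∀ u v, p u → p v → p (u + v))
    (hom : ∀ n (u : ⨂[k]^n V), p (TensorPower.toTensorAlgebra u)) (w) : p w := by
  obtain ⟨w, rfl⟩ := (TensorAlgebra.equivDirectSum (R := k) (M := V)).symm.surjective w
  induction w using DirectSum.induction_on with
  | zero => simpa using zero
  | add u v hu hv => rw [map_add]; exact add _ _ hu hv
  | of n u =>
    have : TensorAlgebra.equivDirectSum.symm (DirectSum.of (fun n => ⨂[k]^n V) n u) =
        TensorPower.toTensorAlgebra u :=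
      DirectSum.toAddMonoid_of
        (fun _ => LinearMap.toAddMonoidHom TensorPower.toTensorAlgebra) _ _
    rw [this]
    exact hom n u

variable {ι : Type*} [Fintype ι] [DecidableEq ι]

/-- Linear maps `D m` on an algebra `A` satisfying the product rule of the skew derivations with
coefficients `C` with respect to elements `y j`. -/
structure SkewCalculus {A : Type*} [Ring A] [Algebra k A] (C : ι → ι → ι → ι → k) (y : ι → A)
    (D : ι → A →ₗ[k] A) : Prop where
  one : ∀ m, D m 1 = 0
  mul : ∀ m j w, D m (y j * w) = (if m = j then w else 0) +
    ∑ i, ∑ l, C j i m l • (y l * D i w)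

variable (e : Module.Basis ι k V) {C : ι → ι → ι → ι → k}

/-- By `hR` the action of `T(V)` on `A × A^ι` factors through `A = T(V)/⟨R⟩`. The second entries of
its value at `(1, 0)` are the maps sought. -/
theorem exists_skewCalculus (R : Set (TensorAlgebra k V))
    (π : TensorAlgebra k V →ₐ[k] Presented R) (hπ : π = RingQuot.mkAlgHom k _)
    (hR : ∀ r ∈ R, skewRep e C (fun j => π (TensorAlgebra.ι k (e j))) r = 0) :
    ∃ D : ι → Presented R →ₗ[k] Presented R,
      SkewCalculus C (fun j => π (TensorAlgebra.ι k (e j))) D := by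
  set y := fun j => π (TensorAlgebra.ι k (e j)) with hy
  let Ψ : Presented R →ₐ[k] Module.End k (Presented R × (ι → Presented R)) :=
    RingQuot.liftAlgHom k ⟨skewRep e C y, fun x y ⟨hx, hy⟩ => by rw [hR x hx, hy, map_zero]⟩
  have hΨ : ∀ w, Ψ (π w) = skewRep e C y w := fun w => by
    rw [hπ]; exact RingQuot.liftAlgHom_mkAlgHom_apply k _ _ w
  refine ⟨fun m => evalOne k _ m ∘ₗ Ψ.toLinearMap, fun m => by simp, fun m j w => ?_⟩
  obtain ⟨w, rfl⟩ : ∃ u, π u = w := by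
    rw [hπ]; exact RingQuot.mkAlgHom_surjective k _ w
  have h := skewRep_apply_fst e C y π (fun _ => rfl) w
  have hj : Ψ (y j) = skewOp C y j := by rw [hy, hΨ, skewRep_ι]
  simp only [LinearMap.comp_apply, AlgHom.toLinearMap_apply, map_mul, hj, evalOne_apply,
    Module.End.mul_apply, hΨ]
  simp [skewOp, h]

theorem SkewCalculus.map_skewDeriv {A : Type*} [Ring A] [Algebra k A]
    {π : TensorAlgebra k V →ₐ[k] A} {D : ι → A →ₗ[k] A}
    (hD : SkewCalculus C (fun j => π (TensorAlgebra.ι k (e j))) D) (m : ι)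
    (w : TensorAlgebra k V) : π (skewDeriv e C m w) = D m (π w) := by
  induction w using ι_mul_induction e generalizing m with
  | one => simp [hD.one]
  | ι_mul j w hw =>
    rw [skewDeriv_ι_mul, map_mul, hD.mul]
    simp only [map_add, map_sum, map_smul, map_mul, hw]
    split_ifs <;> simp
  | add u v hu hv => simp [hu, hv]
  | smul r u hu => simp [hu]

omit [DecidableEq ι] in
theorem augmentation_toTensorAlgebra_succ {A : Type*} [Ring A] [Algebra k A]
    {π : TensorAlgebra k V →ₐ[k] A} (ε : A →ₐ[k] k)
    (hε : ∀ j, ε (π (TensorAlgebra.ι k (e j))) = 0) (n : ℕ) (u : ⨂[k]^(n + 1) V) :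
    ε (π (TensorPower.toTensorAlgebra u)) = 0 := by
  induction u using consTensor_induction e with
  | zero => simp
  | cons j w => simp [hε]
  | add u v hu hv => simp [hu, hv]
  | smul r u hu => simp [hu]

variable (c : Braiding k V)

/-- Induction on the degree: in degree `n + 1` each side amounts to the same statement for all skew
derivatives. An element killed by every `D m` is a scalar, and the augmentation `ε` forces that
scalar to be zero in positive degree. In degree `0`, `ε` shows that `π` is injective on scalars. -/
theorem toTensorAlgebra_mem_relations_iff
    (hC : ∀ i j, c.toMap (e i ⊗ₜ e j) = ∑ m, ∑ l, C i j m l • (e m ⊗ₜ[k] e l))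
    {A : Type*} [Ring A] [Algebra k A] {π : TensorAlgebra k V →ₐ[k] A} {D : ι → A →ₗ[k] A}
    (hD : SkewCalculus C (fun j => π (TensorAlgebra.ι k (e j))) D)
    (ε : A →ₐ[k] k) (hε : ∀ j, ε (π (TensorAlgebra.ι k (e j))) = 0)
    (hker : ∀ w, (∀ m, D m w = 0) → ∃ r, w = algebraMap k A r) (n : ℕ) (u : ⨂[k]^n V) :
    TensorPower.toTensorAlgebra u ∈ relations c n ↔ π (TensorPower.toTensorAlgebra u) = 0 := by
  induction n with
  | zero =>
    obtain ⟨r, hr⟩ := toTensorAlgebra_zero u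
    rw [relations_zero, Submodule.mem_bot, hr]
    refine ⟨fun h => by rw [h, map_zero], fun h => ?_⟩
    have := congrArg ε h
    simp only [AlgHom.commutes, map_zero, Algebra.algebraMap_self, RingHom.id_apply] at this
    rw [this, map_zero]
  | succ n ih =>
    rw [mem_relations_succ c e hC]
    have h : ∀ m, skewDeriv e C m (TensorPower.toTensorAlgebra u) ∈ relations c n ↔
        D m (π (TensorPower.toTensorAlgebra u)) = 0 := fun m => by
      obtain ⟨w, hw⟩ := skewDeriv_mem_range c e hC u m
      rw [← hD.map_skewDeriv, hw, ih]
    simp only [h]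
    refine ⟨fun h => ?_, fun h m => by rw [h, map_zero]⟩
    obtain ⟨r, hr⟩ := hker _ h
    have := augmentation_toTensorAlgebra_succ e ε hε n u
    rw [hr, AlgHom.commutes, Algebra.algebraMap_self, RingHom.id_apply] at this
    rw [hr, this, map_zero]

-- `definingIdeal` is only known to be a subspace, so that it contains the ideal is checked on
-- products `u r v`. After reduction to homogeneous `u` and `v`, such a product is homogeneous of
-- degree at least two and is killed by `π`, hence is a relation.
open scoped Pointwise in
theorem definingIdeal_eq_span
    (hC : ∀ i j, c.toMap (e i ⊗ₜ e j) = ∑ m, ∑ l, C i j m l • (e m ⊗ₜ[k] e l))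
    {R : Set (TensorAlgebra k V)}
    (hR : ∀ r ∈ R, ∃ z : V ⊗[k] V, r = pairMul k V z)
    {π : TensorAlgebra k V →ₐ[k] Presented R} (hπ : π = RingQuot.mkAlgHom k _)
    {D : ι → Presented R →ₗ[k] Presented R}
    (hD : SkewCalculus C (fun j => π (TensorAlgebra.ι k (e j))) D)
    (ε : Presented R →ₐ[k] k) (hε : ∀ j, ε (π (TensorAlgebra.ι k (e j))) = 0)
    (hker : ∀ w, (∀ m, D m w = 0) → ∃ r, w = algebraMap k (Presented R) r) :
    (definingIdeal c : Set (TensorAlgebra k V)) = TwoSidedIdeal.span R := by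
  have key := toTensorAlgebra_mem_relations_iff e c hC hD ε hε hker
  have hπR : ∀ w, π w = 0 ↔ w ∈ TwoSidedIdeal.span R := fun w => by
    rw [hπ]; exact mkAlgHom_eq_zero_iff k R w
  apply Set.Subset.antisymm
  · intro w hw
    rw [SetLike.mem_coe, ← hπR]
    have : definingIdeal c ≤ LinearMap.ker π.toLinearMap := by
      refine iSup₂_le fun n _ => ?_
      rintro _ ⟨u, hu, rfl⟩
      exact (key n u).1 ⟨u, hu, rfl⟩
    exact this hw
  · intro w hw
    rw [SetLike.mem_coe, TwoSidedIdeal.mem_span_iff_mem_addSubgroup_closure] at hw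
    suffices h : AddSubgroup.closure (Set.univ * R * Set.univ) ≤
        (definingIdeal c).toAddSubgroup from h hw
    rw [AddSubgroup.closure_le]
    rintro _ ⟨_, ⟨u, -, r, hr, rfl⟩, v, -, rfl⟩
    change u * r * v ∈ definingIdeal c
    induction u using homogeneous_induction with
    | zero => simp
    | add u u' hu hu' =>
      rw [add_mul, add_mul]
      exact add_mem hu hu'
    | hom i u =>
      induction v using homogeneous_induction with
      | zero => simp
      | add v v' hv hv' =>
        rw [mul_add]
        exact add_mem hv hv'
      | hom j v =>
        obtain ⟨z, rfl⟩ := hR r hr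
        have h : TensorPower.toTensorAlgebra
            (TensorPower.mulEquiv (TensorPower.mulEquiv (u ⊗ₜ pairEquiv k V z) ⊗ₜ v)) =
            TensorPower.toTensorAlgebra u * pairMul k V z * TensorPower.toTensorAlgebra v := by
          simp [toTensorAlgebra_pairEquiv]
        refine Submodule.mem_iSup_of_mem (i + 2 + j)
          (Submodule.mem_iSup_of_mem (by omega) ?_)
        rw [← h, key, h, map_mul, map_mul, (hπR _).2 (TwoSidedIdeal.subset_span hr)]
        simp

end Presentation

/-! ### The braiding of `ℜ_{1,3}` in coordinates, and compatibility of the relations with the skew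
derivations. -/

section RankThree

variable {k : Type*} [Field k]

/-- The coefficients of the braiding `braiding13`. -/
def coeff13 (a b p q t : k) (i j m l : Fin 3) : k :=
  R13 a b p q t (finProdFinEquiv (m, l)) (finProdFinEquiv (j, i))

theorem braiding13_basisFun (a b p q t : k) (ht : t ≠ 0) (i j : Fin 3) :
    (braiding13 a b p q t ht).toMap (Pi.basisFun k (Fin 3) i ⊗ₜ Pi.basisFun k (Fin 3) j) =
      ∑ m, ∑ l, coeff13 a b p q t i j m l •
        (Pi.basisFun k (Fin 3) m ⊗ₜ[k] Pi.basisFun k (Fin 3) l) := by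
  simp only [Pi.basisFun_apply]
  exact mapOfMatrix_tmul _ i j

theorem X_eq (i : Fin 3) : X k i = TensorAlgebra.ι k (Pi.basisFun k (Fin 3) i) := by
  rw [Pi.basisFun_apply]; rfl

variable {A : Type*} [Ring A] [Algebra k A]

/-- With `D i w` for `f i`, the entry `s j m` is the braided term in the product rule for `D m (y j
* w)`. -/
theorem sum_coeff13 (a b p q t : k) (y f : Fin 3 → A) :
    let s := fun j m => ∑ i, ∑ l, coeff13 a b p q t j i m l • (y l * f i)
    s 0 0 = t • (y 0 * f 0) - (t * a) • (y 0 * f 2) ∧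
    s 0 1 = t • (y 0 * f 1) ∧
    s 0 2 = t • (y 0 * f 2) ∧
    s 1 0 = t • (y 1 * f 0) - (t * b) • (y 1 * f 2) ∧
    s 1 1 = t • (y 1 * f 1) ∧
    s 1 2 = t • (y 1 * f 2) ∧
    s 2 0 = t • (y 2 * f 0) + (t * a) • (y 0 * f 0) - (t * b) • (y 2 * f 2) -
      (t * p) • (y 1 * f 2) - (t * a * b) • (y 0 * f 2) ∧
    s 2 1 = t • (y 2 * f 1) + (t * b) • (y 0 * f 1) + (t * q) • (y 1 * f 2) +
      (t * p) • (y 0 * f 2) ∧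
    s 2 2 = t • (y 2 * f 2) + (t * b) • (y 0 * f 2) := by
  have h : ∀ m l : Fin 3, (finProdFinEquiv (m, l) : Fin 9) =
      ⟨l + 3 * m, by omega⟩ := fun m l => rfl
  refine ⟨?_, ?_, ?_, ?_, ?_, ?_, ?_, ?_, ?_⟩ <;>
  · simp [Fin.sum_univ_three, coeff13, h, R13]
    try module

theorem skewOp_coeff13 (a b p q t : k) (y : Fin 3 → A) (w : A) (f : Fin 3 → A) :
    skewOp (coeff13 a b p q t) y 0 (w, f) = (y 0 * w,
      ![w + (t • (y 0 * f 0) - (t * a) • (y 0 * f 2)), t • (y 0 * f 1), t • (y 0 * f 2)]) ∧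
    skewOp (coeff13 a b p q t) y 1 (w, f) = (y 1 * w,
      ![t • (y 1 * f 0) - (t * b) • (y 1 * f 2), w + t • (y 1 * f 1), t • (y 1 * f 2)]) ∧
    skewOp (coeff13 a b p q t) y 2 (w, f) = (y 2 * w,
      ![t • (y 2 * f 0) + (t * a) • (y 0 * f 0) - (t * b) • (y 2 * f 2) -
          (t * p) • (y 1 * f 2) - (t * a * b) • (y 0 * f 2),
        t • (y 2 * f 1) + (t * b) • (y 0 * f 1) + (t * q) • (y 1 * f 2) +
          (t * p) • (y 0 * f 2),
        w + (t • (y 2 * f 2) + (t * b) • (y 0 * f 2))]) := by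
  obtain ⟨h00, h01, h02, h10, h11, h12, h20, h21, h22⟩ := sum_coeff13 a b p q t y f
  refine ⟨?_, ?_, ?_⟩ <;>
  · refine Prod.ext rfl (funext fun m => ?_)
    fin_cases m <;> simp_all [skewOp]

/-- The relations of the Nichols algebra for `t = 1`. -/
def relSymm (a b : k) : Set (TensorAlgebra k (Fin 3 → k)) :=
  {X k 1 * X k 0 - X k 0 * X k 1, X k 2 * X k 0 - X k 0 * X k 2 - a • X k 0 ^ 2,
    X k 2 * X k 1 - X k 1 * X k 2 - b • (X k 0 * X k 1)}

/-- The relations of the Nichols algebra for `t = -1` and `q ≠ 0`. -/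
def relSkew (b : k) : Set (TensorAlgebra k (Fin 3 → k)) :=
  {X k 1 * X k 0 + X k 0 * X k 1, X k 2 * X k 0 + X k 0 * X k 2,
    X k 2 * X k 1 + X k 1 * X k 2 - b • (X k 0 * X k 1), X k 0 ^ 2, X k 1 ^ 2}

/-- The relations of the Nichols algebra for `t = -1` and `q = 0`. -/
def relExt (b p : k) : Set (TensorAlgebra k (Fin 3 → k)) :=
  {X k 1 * X k 0 + X k 0 * X k 1, X k 2 * X k 0 + X k 0 * X k 2,
    X k 2 * X k 1 + X k 1 * X k 2 - b • (X k 0 * X k 1), X k 0 ^ 2, X k 1 ^ 2,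
    X k 2 ^ 2 - b • (X k 0 * X k 2) - p • (X k 0 * X k 1)}

/-- The relations for `t = 1`, as equations in an algebra. -/
structure SymmRel (a b : k) (y : Fin 3 → A) : Prop where
  h10 : y 1 * y 0 = y 0 * y 1
  h20 : y 2 * y 0 = y 0 * y 2 + a • (y 0 * y 0)
  h21 : y 2 * y 1 = y 1 * y 2 + b • (y 0 * y 1)

/-- The relations for `t = -1` and `q ≠ 0`, as equations in an algebra. -/
structure SkewRel (b : k) (y : Fin 3 → A) : Prop where
  h10 : y 1 * y 0 = -(y 0 * y 1)
  h20 : y 2 * y 0 = -(y 0 * y 2)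
  h21 : y 2 * y 1 = -(y 1 * y 2) + b • (y 0 * y 1)
  h00 : y 0 * y 0 = 0
  h11 : y 1 * y 1 = 0

theorem symmRel_iff (a b : k) (π : TensorAlgebra k (Fin 3 → k) →ₐ[k] A) :
    (∀ r ∈ relSymm a b, π r = 0) ↔ SymmRel a b fun j => π (X k j) := by
  simp only [relSymm, Set.mem_insert_iff, Set.mem_singleton_iff, forall_eq_or_imp, forall_eq,
    map_sub, map_mul, map_smul, pow_two]
  constructor
  · rintro ⟨h1, h2, h3⟩
    refine ⟨sub_eq_zero.1 h1, ?_, ?_⟩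
    · rwa [sub_sub, sub_eq_zero] at h2
    · rwa [sub_sub, sub_eq_zero] at h3
  · rintro ⟨h1, h2, h3⟩
    refine ⟨sub_eq_zero.2 h1, ?_, ?_⟩
    · rw [sub_sub, h2, sub_self]
    · rw [sub_sub, h3, sub_self]

theorem skewRel_iff (b : k) (π : TensorAlgebra k (Fin 3 → k) →ₐ[k] A) :
    (∀ r ∈ relSkew b, π r = 0) ↔ SkewRel b fun j => π (X k j) := by
  simp only [relSkew, Set.mem_insert_iff, Set.mem_singleton_iff, forall_eq_or_imp, forall_eq,
    map_sub, map_add, map_mul, map_smul, pow_two]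
  constructor
  · rintro ⟨h1, h2, h3, h4, h5⟩
    refine ⟨eq_neg_of_add_eq_zero_left h1, eq_neg_of_add_eq_zero_left h2, ?_, h4, h5⟩
    rw [sub_eq_zero] at h3
    rw [← h3]; abel
  · rintro ⟨h1, h2, h3, h4, h5⟩
    refine ⟨by rw [h1]; abel, by rw [h2]; abel, by rw [h3]; abel, h4, h5⟩

theorem extRel_iff (b p : k) (π : TensorAlgebra k (Fin 3 → k) →ₐ[k] A) :
    (∀ r ∈ relExt b p, π r = 0) ↔ SkewRel b (fun j => π (X k j)) ∧
      π (X k 2) * π (X k 2) = b • (π (X k 0) * π (X k 2)) + p • (π (X k 0) * π (X k 1)) := by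
  rw [← skewRel_iff, ← sub_eq_zero (a := π (X k 2) * π (X k 2)), ← sub_sub]
  simp [relSkew, relExt, pow_two, and_assoc]

variable {a b p q : k} {y : Fin 3 → A}

/-- This is the hypothesis of `exists_skewCalculus`: both sides are compared on each coordinate
after moving the generators into standard order. -/
theorem SymmRel.skewOp (h : SymmRel a b y) :
    SymmRel a b (Nichols.skewOp (coeff13 a b p q 1) y) := by
  have h10 : ∀ w, y 1 * (y 0 * w) = y 0 * (y 1 * w) := fun w => by
    rw [← mul_assoc, h.h10, mul_assoc]
  have h20 : ∀ w, y 2 * (y 0 * w) = y 0 * (y 2 * w) + a • (y 0 * (y 0 * w)) := fun w => by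
    rw [← mul_assoc, h.h20]; simp [add_mul, mul_assoc]
  have h21 : ∀ w, y 2 * (y 1 * w) = y 1 * (y 2 * w) + b • (y 0 * (y 1 * w)) := fun w => by
    rw [← mul_assoc, h.h21]; simp [add_mul, mul_assoc]
  constructor
  all_goals
    refine LinearMap.ext fun ⟨w, f⟩ => ?_
    obtain ⟨s0, s1, s2⟩ : (∀ w f, _) ∧ (∀ w f, _) ∧ (∀ w f, _) :=
      ⟨fun w f => (skewOp_coeff13 a b p q 1 y w f).1,
       fun w f => (skewOp_coeff13 a b p q 1 y w f).2.1,
       fun w f => (skewOp_coeff13 a b p q 1 y w f).2.2⟩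
    simp only [Module.End.mul_apply, LinearMap.add_apply, LinearMap.smul_apply, s0, s1, s2]
    refine Prod.ext ?_ (funext fun m => ?_)
    · simp [h10, h20, h21]
    · fin_cases m <;>
      · simp [h10, h20, h21, mul_add, mul_sub]
        try module

theorem SkewRel.skewOp (h : SkewRel b y) :
    SkewRel b (Nichols.skewOp (coeff13 a b p q (-1)) y) := by
  have h10 : ∀ w, y 1 * (y 0 * w) = -(y 0 * (y 1 * w)) := fun w => by
    rw [← mul_assoc, h.h10, neg_mul, mul_assoc]
  have h20 : ∀ w, y 2 * (y 0 * w) = -(y 0 * (y 2 * w)) := fun w => by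
    rw [← mul_assoc, h.h20, neg_mul, mul_assoc]
  have h21 : ∀ w, y 2 * (y 1 * w) = -(y 1 * (y 2 * w)) + b • (y 0 * (y 1 * w)) := fun w => by
    rw [← mul_assoc, h.h21]; simp [add_mul, mul_assoc]
  have h00 : ∀ w, y 0 * (y 0 * w) = 0 := fun w => by rw [← mul_assoc, h.h00, zero_mul]
  have h11 : ∀ w, y 1 * (y 1 * w) = 0 := fun w => by rw [← mul_assoc, h.h11, zero_mul]
  constructor
  all_goals
    refine LinearMap.ext fun ⟨w, f⟩ => ?_
    obtain ⟨s0, s1, s2⟩ : (∀ w f, _) ∧ (∀ w f, _) ∧ (∀ w f, _) :=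
      ⟨fun w f => (skewOp_coeff13 a b p q (-1) y w f).1,
       fun w f => (skewOp_coeff13 a b p q (-1) y w f).2.1,
       fun w f => (skewOp_coeff13 a b p q (-1) y w f).2.2⟩
    simp only [Module.End.mul_apply, LinearMap.add_apply, LinearMap.smul_apply,
      LinearMap.neg_apply, LinearMap.zero_apply, s0, s1, s2]
    refine Prod.ext ?_ (funext fun m => ?_)
    · simp [h10, h20, h21, h00, h11]
    · fin_cases m <;>
      · simp [h10, h20, h21, h00, h11, mul_add]
        try module

/-- Here `q = 0` matters: the `D 1` component of `y 2 * y 2` is `-q • y 1 - p • y 0`, while that of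
the right-hand side is `-p • y 0`. -/
theorem SkewRel.skewOp_sq (h : SkewRel b y)
    (h22 : y 2 * y 2 = b • (y 0 * y 2) + p • (y 0 * y 1)) :
    let s := Nichols.skewOp (coeff13 a b p 0 (-1)) y
    s 2 * s 2 = b • (s 0 * s 2) + p • (s 0 * s 1) := by
  intro s
  have h10 : ∀ w, y 1 * (y 0 * w) = -(y 0 * (y 1 * w)) := fun w => by
    rw [← mul_assoc, h.h10, neg_mul, mul_assoc]
  have h20 : ∀ w, y 2 * (y 0 * w) = -(y 0 * (y 2 * w)) := fun w => by
    rw [← mul_assoc, h.h20, neg_mul, mul_assoc]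
  have h21 : ∀ w, y 2 * (y 1 * w) = -(y 1 * (y 2 * w)) + b • (y 0 * (y 1 * w)) := fun w => by
    rw [← mul_assoc, h.h21]; simp [add_mul, mul_assoc]
  have h00 : ∀ w, y 0 * (y 0 * w) = 0 := fun w => by rw [← mul_assoc, h.h00, zero_mul]
  have h22' : ∀ w, y 2 * (y 2 * w) = b • (y 0 * (y 2 * w)) + p • (y 0 * (y 1 * w)) := fun w => by
    rw [← mul_assoc, h22]; simp [add_mul, mul_assoc]
  refine LinearMap.ext fun ⟨w, f⟩ => ?_
  obtain ⟨s0, s1, s2⟩ : (∀ w f, _) ∧ (∀ w f, _) ∧ (∀ w f, _) :=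
    ⟨fun w f => (skewOp_coeff13 a b p 0 (-1) y w f).1,
     fun w f => (skewOp_coeff13 a b p 0 (-1) y w f).2.1,
     fun w f => (skewOp_coeff13 a b p 0 (-1) y w f).2.2⟩
  simp only [Module.End.mul_apply, LinearMap.add_apply, LinearMap.smul_apply, s, s0, s1, s2]
  refine Prod.ext ?_ (funext fun m => ?_)
  · simp [h22']
  · fin_cases m <;>
    · simp [h10, h20, h21, h00, h22', mul_add]
      try module

end RankThree

/-! ### Constants of the skew derivations and independence of the monomials. -/

section Triangular

variable {k : Type*} [Field k] {A : Type*} [Ring A] [Algebra k A]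

/-- The element `y_1^{a_1} y_2^{a_2} y_3^{a_3}`. -/
def mon (y : Fin 3 → A) (e : ℕ × ℕ × ℕ) : A := y 0 ^ e.1 * y 1 ^ e.2.1 * y 2 ^ e.2.2

variable {a b p q t : k} {y : Fin 3 → A} {D : Fin 3 → A →ₗ[k] A}

/-- Functionals which are triangular on the monomials with exponents in `S`, with respect to the
exponent of `y_3`, and vanish on the constants of the `D m`, except for the one at the exponent
`(0, 0, 0)`. -/
def HasTriangularFunctionals (y : Fin 3 → A) (D : Fin 3 → A →ₗ[k] A) (S : Set (ℕ × ℕ × ℕ)) :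
    Prop :=
  ∀ e ∈ S, ∃ F : A →ₗ[k] k, (∀ e' ∈ S, e' ≠ e → e'.2.2 ≤ e.2.2 → F (mon y e') = 0) ∧
    F (mon y e) ≠ 0 ∧ (e ≠ 0 → ∀ w, (∀ m, D m w = 0) → F w = 0)

/-- Among the nonzero exponents in the support, choose one with the largest exponent of `y 2`. Its
functional kills every other monomial that occurs, and it kills the whole combination, so the
coefficient vanishes. -/
theorem HasTriangularFunctionals.eq_zero_of_mem_support {S : Set (ℕ × ℕ × ℕ)}
    (h : HasTriangularFunctionals y D S) (l : S →₀ k)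
    (hl : ∀ m, D m (Finsupp.linearCombination k (fun e : S => mon y e.1) l) = 0) :
    ∀ e ∈ l.support, e.1 = 0 := by
  classical
  by_contra! hne
  obtain ⟨e₀, he₀, hne₀⟩ := hne
  obtain ⟨e, he, hmax⟩ := (l.support.filter fun e => e.1 ≠ 0).exists_max_image
    (fun e => e.1.2.2) ⟨e₀, by simpa using ⟨by simpa using he₀, hne₀⟩⟩
  rw [Finset.mem_filter] at he
  obtain ⟨F, h1, h2, h3⟩ := h e.1 e.2
  have := h3 he.2 _ hl
  rw [Finsupp.linearCombination_apply, Finsupp.sum, map_sum,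
    Finset.sum_eq_single_of_mem e he.1, map_smul, smul_eq_mul, mul_eq_zero] at this
  · exact this.elim (Finsupp.mem_support_iff.1 he.1) h2
  · intro e' he' hne'
    rw [map_smul, h1 e'.1 e'.2 (fun h => hne' (Subtype.ext h)), smul_zero]
    by_cases h0 : e'.1 = 0
    · simp [h0]
    · exact hmax e' (Finset.mem_filter.2 ⟨he', h0⟩)

theorem HasTriangularFunctionals.linearIndependent {S : Set (ℕ × ℕ × ℕ)}
    (h : HasTriangularFunctionals y D S) : LinearIndependent k (fun e : S => mon y e.1) := by
  rw [linearIndependent_iff]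
  intro l hl
  have h0 := h.eq_zero_of_mem_support l (by simp [hl])
  ext e
  by_contra hne
  have he : e.1 = 0 := h0 e (Finsupp.mem_support_iff.2 hne)
  have hle : l = Finsupp.single e (l e) := by
    ext e'
    by_cases hee : e = e'
    · simp [hee]
    · rw [Finsupp.single_eq_of_ne' hee]
      by_contra hne'
      exact hee (Subtype.ext (he.trans (h0 e' (Finsupp.mem_support_iff.2 hne')).symm))
  obtain ⟨F, -, h2, -⟩ := h e.1 e.2
  rw [hle, Finsupp.linearCombination_single] at hl
  have := congrArg F hl
  rw [map_smul, map_zero, smul_eq_mul, mul_eq_zero] at this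
  exact this.elim hne h2

theorem HasTriangularFunctionals.eq_algebraMap {S : Set (ℕ × ℕ × ℕ)}
    (h : HasTriangularFunctionals y D S)
    (hS : Submodule.span k (Set.range fun e : S => mon y e.1) = ⊤) (w : A)
    (hw : ∀ m, D m w = 0) : ∃ r, w = algebraMap k A r := by
  obtain ⟨l, rfl⟩ : ∃ l, Finsupp.linearCombination k (fun e : S => mon y e.1) l = w := by
    rw [← LinearMap.mem_range, Finsupp.range_linearCombination, hS]
    trivial
  have h0 := h.eq_zero_of_mem_support l hw
  refine ⟨∑ e ∈ l.support, l e, ?_⟩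
  rw [Finsupp.linearCombination_apply, Finsupp.sum, map_sum]
  refine Finset.sum_congr rfl fun e he => ?_
  rw [h0 e he, Algebra.algebraMap_eq_smul_one]
  simp [mon]

/-- The rule for `D 0 (y 2 * w)` is left out: in the functionals below, `D 0` meets only monomials
from which `y 2` has already been removed. -/
theorem SkewCalculus.rules (hD : SkewCalculus (coeff13 a b p q t) y D) (w : A) :
    D 0 (y 0 * w) = w + (t • (y 0 * D 0 w) - (t * a) • (y 0 * D 2 w)) ∧
    D 1 (y 0 * w) = t • (y 0 * D 1 w) ∧
    D 2 (y 0 * w) = t • (y 0 * D 2 w) ∧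
    D 0 (y 1 * w) = t • (y 1 * D 0 w) - (t * b) • (y 1 * D 2 w) ∧
    D 1 (y 1 * w) = w + t • (y 1 * D 1 w) ∧
    D 2 (y 1 * w) = t • (y 1 * D 2 w) ∧
    D 1 (y 2 * w) = t • (y 2 * D 1 w) + (t * b) • (y 0 * D 1 w) + (t * q) • (y 1 * D 2 w) +
      (t * p) • (y 0 * D 2 w) ∧
    D 2 (y 2 * w) = w + (t • (y 2 * D 2 w) + (t * b) • (y 0 * D 2 w)) := by
  obtain ⟨h00, h01, h02, h10, h11, h12, h20, h21, h22⟩ :=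
    sum_coeff13 a b p q t y fun i => D i w
  simp only [hD.mul, h00, h01, h02, h10, h11, h12, h21, h22]
  simp

/-! ### The symmetric case -/

theorem SkewCalculus.pow_apply_mon (hD : SkewCalculus (coeff13 a b p q 1) y D) (n i j c : ℕ) :
    (D 2 ^ n) (mon y (i, j, c)) = y 0 ^ i * y 1 ^ j * (D 2 ^ n) (y 2 ^ c) := by
  have h0 : ∀ n w, (D 2 ^ n) (y 0 * w) = y 0 * (D 2 ^ n) w := fun n => by
    induction n with
    | zero => simp
    | succ n ih => intro w; simp [pow_succ, ih, (hD.rules w).2.2.1]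
  have h1 : ∀ n w, (D 2 ^ n) (y 1 * w) = y 1 * (D 2 ^ n) w := fun n => by
    induction n with
    | zero => simp
    | succ n ih => intro w; simp [pow_succ, ih, (hD.rules w).2.2.2.2.2.1]
  have h0' : ∀ i w, (D 2 ^ n) (y 0 ^ i * w) = y 0 ^ i * (D 2 ^ n) w := fun i w => by
    induction i with
    | zero => simp
    | succ i ih => rw [pow_succ', mul_assoc, h0, ih, mul_assoc]
  have h1' : ∀ i w, (D 2 ^ n) (y 1 ^ i * w) = y 1 ^ i * (D 2 ^ n) w := fun i w => by
    induction i with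
    | zero => simp
    | succ i ih => rw [pow_succ', mul_assoc, h1, ih, mul_assoc]
  rw [mon, mul_assoc, h0', h1', mul_assoc]

/-- Iterating the product rule gives `h2`. Applied to `w = y 2 ^ c` with `c ≤ n`, only its first
term survives, and the factors `n + 1` accumulate to the factorial. -/
theorem SkewCalculus.pow_apply_pow (hD : SkewCalculus (coeff13 a b p q 1) y D) (n c : ℕ)
    (hc : c ≤ n) : (D 2 ^ n) (y 2 ^ c) = if c = n then (n.factorial : k) • 1 else 0 := by
  have h0 : ∀ n w, (D 2 ^ n) (y 0 * w) = y 0 * (D 2 ^ n) w := fun n => by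
    induction n with
    | zero => simp
    | succ n ih => intro w; simp [pow_succ, ih, (hD.rules w).2.2.1]
  have h2 : ∀ n w, (D 2 ^ (n + 1)) (y 2 * w) = ((n + 1 : ℕ) : k) • (D 2 ^ n) w +
      (y 2 * (D 2 ^ (n + 1)) w + ((n + 1 : ℕ) * b) • (y 0 * (D 2 ^ (n + 1)) w)) := fun n => by
    induction n with
    | zero => intro w; simp [(hD.rules w).2.2.2.2.2.2.2]
    | succ n ih =>
      intro w
      rw [pow_succ, Module.End.mul_apply, (hD.rules w).2.2.2.2.2.2.2]
      simp only [map_add, map_smul, ih, h0, ← Module.End.mul_apply, ← pow_succ]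
      push_cast
      module
  induction c generalizing n with
  | zero =>
    cases n with
    | zero => simp
    | succ n => simp [pow_succ, hD.one]
  | succ c ih =>
    obtain ⟨n, rfl⟩ : ∃ m, n = m + 1 := ⟨n - 1, by omega⟩
    rw [pow_succ' (y 2), h2, ih n (by omega), ih (n + 1) (by omega)]
    by_cases hcn : c = n
    · simp [hcn, Nat.factorial_succ, smul_smul]
    · have : c ≠ n + 1 := by omega
      simp [hcn, this]

/-- `D 2` vanishes on monomials without `y 2`, so the corrections by `a` and `b` drop out and `D 0`,
`D 1` act as ordinary partial derivatives. -/
theorem SkewCalculus.pow_zero_pow_one (hD : SkewCalculus (coeff13 a b p q 1) y D)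
    (m n i j : ℕ) : (D 0 ^ m * D 1 ^ n) (y 0 ^ i * y 1 ^ j) =
      ((i.descFactorial m : k) * j.descFactorial n) • (y 0 ^ (i - m) * y 1 ^ (j - n)) := by
  have h2 : ∀ i j, D 2 (y 0 ^ i * y 1 ^ j) = 0 := fun i j => by
    simpa [mon, hD.one] using hD.pow_apply_mon 1 i j 0
  have h1 : ∀ i j : ℕ, D 1 (y 0 ^ i * y 1 ^ j) = (j : k) • (y 0 ^ i * y 1 ^ (j - 1)) := fun i j => by
    induction i with
    | zero =>
      simp only [pow_zero, one_mul]
      induction j with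
      | zero => simp [hD.one]
      | succ j ih =>
        rw [pow_succ', (hD.rules _).2.2.2.2.1, ih]
        cases j with
        | zero => simp
        | succ j => simp [pow_succ', add_smul, add_comm, mul_add]
    | succ i ih => rw [pow_succ', mul_assoc, (hD.rules _).2.1, ih]; simp [mul_assoc]
  have h0 : ∀ i j : ℕ, D 0 (y 0 ^ i * y 1 ^ j) = (i : k) • (y 0 ^ (i - 1) * y 1 ^ j) := fun i j => by
    induction i with
    | zero =>
      simp only [pow_zero, one_mul, Nat.cast_zero, zero_smul]
      induction j with
      | zero => simp [hD.one]
      | succ j ih =>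
        have := h2 0 j
        rw [pow_zero, one_mul] at this
        rw [pow_succ', (hD.rules _).2.2.2.1, ih, this]
        simp
    | succ i ih =>
      rw [pow_succ', mul_assoc, (hD.rules _).1, ih, h2]
      cases i with
      | zero => simp
      | succ i => simp [pow_succ', add_smul, add_comm, mul_add, mul_assoc]
  rw [Module.End.mul_apply]
  have h1' : (D 1 ^ n) (y 0 ^ i * y 1 ^ j) =
      (j.descFactorial n : k) • (y 0 ^ i * y 1 ^ (j - n)) := by
    induction n with
    | zero => simp
    | succ n ih =>
      rw [pow_succ', Module.End.mul_apply, ih, map_smul, h1, smul_smul, Nat.descFactorial_succ,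
        Nat.sub_sub]
      push_cast
      rw [mul_comm]
  rw [h1', map_smul, mul_comm, mul_smul]
  congr 1
  induction m with
  | zero => simp
  | succ m ih =>
    rw [pow_succ', Module.End.mul_apply, ih, map_smul, h0, smul_smul, Nat.descFactorial_succ,
      Nat.sub_sub]
    push_cast
    rw [mul_comm]

theorem end_pow_apply_eq_zero {f : Module.End k A} {w : A} (h : f w = 0) {n : ℕ} (hn : n ≠ 0) :
    (f ^ n) w = 0 := by
  obtain ⟨m, rfl⟩ := Nat.exists_eq_succ_of_ne_zero hn
  rw [pow_succ, Module.End.mul_apply, h, map_zero]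

/-- The functional is `ε D_0^{e₁} D_1^{e₂} D_2^{e₃}`, with value `e₁! e₂! e₃!` on its own monomial,
nonzero in characteristic zero. It kills constants because the first operator with a nonzero
exponent does. -/
theorem SkewCalculus.hasTriangularFunctionals_symm [CharZero k]
    (hD : SkewCalculus (coeff13 a b p q 1) y D) (ε : A →ₐ[k] k) (hε : ∀ j, ε (y j) = 0) :
    HasTriangularFunctionals y D B3 := by
  rintro ⟨e₁, e₂, e₃⟩ -
  refine ⟨ε.toLinearMap ∘ₗ (D 0 ^ e₁ * D 1 ^ e₂) ∘ₗ (D 2 ^ e₃), ?_, ?_, ?_⟩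
  · rintro ⟨i, j, c⟩ - hne hc
    simp only at hc
    simp only [LinearMap.comp_apply, hD.pow_apply_mon, hD.pow_apply_pow _ _ hc]
    split_ifs with hce
    · simp only [mul_smul_comm, mul_one, map_smul, hD.pow_zero_pow_one, AlgHom.toLinearMap_apply,
        map_mul, map_pow, hε]
      -- An exponent that is too small is killed by the derivations, one that is too large leaves a
      -- generator for `ε` to kill.
      rcases lt_trichotomy i e₁ with h | h | h
      · simp [Nat.descFactorial_of_lt h]
      · rcases lt_trichotomy j e₂ with h' | h' | h'
        · simp [Nat.descFactorial_of_lt h']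
        · exact absurd (by rw [h, h', hce]) hne
        · rw [zero_pow (n := j - e₂) (by omega)]; simp
      · rw [zero_pow (n := i - e₁) (by omega)]; simp
    · simp
  · simp only [LinearMap.comp_apply, hD.pow_apply_mon, hD.pow_apply_pow _ _ le_rfl]
    simp only [if_true, mul_smul_comm, mul_one, map_smul, hD.pow_zero_pow_one]
    simp [Nat.descFactorial_self, Nat.factorial_ne_zero]
  · intro hne w hw
    simp only [LinearMap.comp_apply, Module.End.mul_apply]
    by_cases h3 : e₃ = 0
    · subst h3
      by_cases h2 : e₂ = 0
      · subst h2
        have h1 : e₁ ≠ 0 := fun h => hne (by rw [h]; rfl)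
        simp [end_pow_apply_eq_zero (hw 0) h1]
      · simp [end_pow_apply_eq_zero (hw 1) h2]
    · simp [end_pow_apply_eq_zero (hw 2) h3]

/-! ### The skew case -/

/-- The kernels of `D 2 ∘ D 2` and `D 2 ∘ D 1 + D 1 ∘ D 2` contain `1` and, by the product rules,
are stable under left multiplication by the generators. Since `D 2` squares to zero, it sees only
the parity of a power of `y 2`. -/
theorem SkewCalculus.skew_comm (hD : SkewCalculus (coeff13 a b p q (-1)) y D)
    (hy : ∀ N : Submodule k A, 1 ∈ N → (∀ j, ∀ w ∈ N, y j * w ∈ N) → ∀ w, w ∈ N) :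
    (∀ w, D 2 (D 2 w) = 0) ∧ ∀ w, D 2 (D 1 w) = -D 1 (D 2 w) := by
  have r := fun w => hD.rules w
  simp only [forall_and, neg_smul, one_smul, neg_one_mul] at r
  obtain ⟨r1, r2, r3, r4, r5, r6, r7, r8⟩ := r
  have h22 : ∀ w, D 2 (D 2 w) = 0 := by
    refine hy (LinearMap.ker (D 2 ∘ₗ D 2)) (by simp [hD.one]) fun j w hw => ?_
    simp only [LinearMap.mem_ker, LinearMap.comp_apply] at hw ⊢
    fin_cases j <;> simp [r3, r6, r8, hw]
  refine ⟨h22, ?_⟩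
  have : ∀ w, w ∈ LinearMap.ker (D 2 ∘ₗ D 1 + D 1 ∘ₗ D 2) := by
    refine hy _ (by simp [hD.one]) fun j w hw => ?_
    simp only [LinearMap.mem_ker, LinearMap.comp_apply, LinearMap.add_apply] at hw ⊢
    have hw' := eq_neg_of_add_eq_zero_left hw
    fin_cases j <;> simp [r2, r3, r5, r6, r7, r8, h22, hw']
    module
  exact fun w => eq_neg_of_add_eq_zero_left (this w)

/-- For `Z = D 1 * D 1` the product rule is `Z (y 2 * w) = y 2 * Z w + 2b • y 0 * Z w - q • D 2 w`,
so one application of `Z` removes a letter at the cost of a `D 2`, which removes another. The even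
and odd cases feed each other and are proved together. -/
theorem SkewCalculus.sq_pow_apply_pow (hD : SkewCalculus (coeff13 a b p q (-1)) y D)
    (hy : ∀ N : Submodule k A, 1 ∈ N → (∀ j, ∀ w ∈ N, y j * w ∈ N) → ∀ w, w ∈ N) (c n : ℕ) :
    (c ≤ 2 * n → ((D 1 * D 1) ^ n) (y 2 ^ c) =
      if c = 2 * n then ((-q) ^ n * n.factorial) • 1 else 0) ∧
    (c ≤ 2 * n + 1 → (D 2 * (D 1 * D 1) ^ n) (y 2 ^ c) =
      if c = 2 * n + 1 then ((-q) ^ n * n.factorial) • 1 else 0) := by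
  obtain ⟨h22, h21⟩ := hD.skew_comm hy
  have r := fun w => hD.rules w
  simp only [forall_and, neg_smul, one_smul, neg_one_mul] at r
  obtain ⟨r1, r2, r3, r4, r5, r6, r7, r8⟩ := r
  set Z : Module.End k A := D 1 * D 1 with hZ
  have hZa : ∀ w, Z w = D 1 (D 1 w) := fun _ => rfl
  have hZ0 : ∀ n w, (Z ^ n) (y 0 * w) = y 0 * (Z ^ n) w := fun n => by
    induction n with
    | zero => simp
    | succ n ih => intro w; simp [pow_succ, ih, hZa, r2]
  have hZD : ∀ n w, D 2 ((Z ^ n) w) = (Z ^ n) (D 2 w) := fun n => by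
    induction n with
    | zero => simp
    | succ n ih => intro w; simp [pow_succ, ih, hZa, h21]
  have hZ2 : ∀ n w, (Z ^ (n + 1)) (y 2 * w) = y 2 * (Z ^ (n + 1)) w +
      (2 * (n + 1 : ℕ) * b) • (y 0 * (Z ^ (n + 1)) w) -
        ((n + 1 : ℕ) * q) • D 2 ((Z ^ n) w) := fun n => by
    induction n with
    | zero =>
      intro w
      simp [hZa, r2, r5, r7, h21]
      module
    | succ n ih =>
      intro w
      have h1 : Z (y 2 * w) = y 2 * Z w + (2 * b) • (y 0 * Z w) - q • D 2 w := by
        simp [hZa, r2, r5, r7, h21]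
        module
      rw [pow_succ, Module.End.mul_apply, h1]
      simp only [map_add, map_sub, map_smul, ih, hZ0, ← Module.End.mul_apply, ← pow_succ]
      simp only [Module.End.mul_apply, hZD]
      push_cast
      module
  have hDZ2 : ∀ (n : ℕ) w, D 2 ((Z ^ n) (y 2 * w)) = (Z ^ n) w - (y 2 * (Z ^ n) (D 2 w) +
      ((2 * n + 1) * b) • (y 0 * (Z ^ n) (D 2 w))) := fun n w => by
    cases n with
    | zero => simp [r8]; module
    | succ n =>
      rw [hZ2]
      simp only [map_add, map_sub, map_smul, r8, r3, h22, hZD, map_zero, smul_zero, sub_zero]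
      push_cast
      module
  simp only [Module.End.mul_apply]
  induction c generalizing n with
  | zero =>
    refine ⟨fun _ => ?_, fun _ => ?_⟩
    · cases n with
      | zero => simp
      | succ n => simp [pow_succ, hZa, hD.one]
    · simp [hZD, hD.one]
  | succ c ih =>
    refine ⟨fun hc => ?_, fun hc => ?_⟩
    · obtain ⟨n, rfl⟩ : ∃ m, n = m + 1 := ⟨n - 1, by omega⟩
      rw [pow_succ' (y 2), hZ2, (ih (n + 1)).1 (by omega), (ih n).2 (by omega),
        if_neg (show ¬ c = 2 * (n + 1) by omega)]
      by_cases h : c = 2 * n + 1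
      · rw [if_pos h, if_pos (by omega), Nat.factorial_succ]
        push_cast
        simp only [mul_zero, smul_zero, zero_add, zero_sub, smul_smul, ← neg_smul]
        congr 1
        ring
      · rw [if_neg h, if_neg (by omega)]
        simp
    · rw [pow_succ' (y 2), hDZ2, (ih n).1 (by omega), ← hZD, (ih n).2 (by omega),
        if_neg (show ¬ c = 2 * n + 1 by omega)]
      by_cases h : c = 2 * n
      · simp [h]
      · simp [h]

theorem SkewCalculus.hasTriangularFunctionals_skew [CharZero k]
    (hD : SkewCalculus (coeff13 a b p q (-1)) y D) (ε : A →ₐ[k] k) (hε : ∀ j, ε (y j) = 0)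
    (hy : ∀ N : Submodule k A, 1 ∈ N → (∀ j, ∀ w ∈ N, y j * w ∈ N) → ∀ w, w ∈ N)
    {S : Set (ℕ × ℕ × ℕ)} (hS : ∀ e ∈ S, e.1 < 2 ∧ e.2.1 < 2 ∧ (q ≠ 0 ∨ e.2.2 < 2)) :
    HasTriangularFunctionals y D S := by
  have r := fun w => hD.rules w
  simp only [forall_and, neg_smul, one_smul, neg_one_mul] at r
  obtain ⟨r1, r2, r3, r4, r5, r6, r7, r8⟩ := r
  set Z : Module.End k A := D 1 * D 1 with hZ
  have hZa : ∀ w, Z w = D 1 (D 1 w) := fun _ => rfl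
  have hZ0 : ∀ n w, (Z ^ n) (y 0 * w) = y 0 * (Z ^ n) w := fun n => by
    induction n with
    | zero => simp
    | succ n ih => intro w; simp [pow_succ, ih, hZa, r2]
  have hZ1 : ∀ n w, (Z ^ n) (y 1 * w) = y 1 * (Z ^ n) w := fun n => by
    induction n with
    | zero => simp
    | succ n ih => intro w; simp [pow_succ, ih, hZa, r5]
  -- `Z` lowers the exponent of `y 2` by two and `D 2` takes care of the remaining parity.
  let H : ℕ → Module.End k A := fun n => D 2 ^ (n % 2) * Z ^ (n / 2)
  have hH : ∀ n i j c, i < 2 → j < 2 → c ≤ n → ∃ s : k, s ≠ 0 ∧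
      H n (mon y (i, j, c)) = if c = n then (s * ((-q) ^ (n / 2) * (n / 2).factorial)) •
        (y 0 ^ i * y 1 ^ j) else 0 := by
    intro n i j c hi hj hc
    have h1 := (hD.sq_pow_apply_pow hy c (n / 2)).1
    have h2 := (hD.sq_pow_apply_pow hy c (n / 2)).2
    have hn := Nat.div_add_mod n 2
    rw [← hZ, Module.End.mul_apply] at h2
    rw [← hZ] at h1
    rcases Nat.mod_two_eq_zero_or_one n with h | h
    · have h1 := h1 (by omega)
      rw [show 2 * (n / 2) = n by omega] at h1
      refine ⟨1, one_ne_zero, ?_⟩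
      simp only [H, h, pow_zero, one_mul, mon]
      interval_cases i <;> interval_cases j <;> simp [mul_assoc, hZ0, hZ1, h1]
    · have h2 := h2 (by omega)
      rw [show 2 * (n / 2) + 1 = n by omega] at h2
      -- `Z` passes `y 0` and `y 1` freely, whereas `D 2` changes sign at each of them.
      refine ⟨(-1) ^ (i + j), by simp, ?_⟩
      simp only [H, h, pow_one, Module.End.mul_apply, mon]
      interval_cases i <;> interval_cases j <;>
        simp [mul_assoc, hZ0, hZ1, r3, r6, h2] <;> split_ifs <;> simp
  have hG : ∀ e₁ e₂ i j, e₁ < 2 → e₂ < 2 → i < 2 → j < 2 → ∃ s : k, s ≠ 0 ∧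
      ε ((D 0 ^ e₁ * D 1 ^ e₂) (y 0 ^ i * y 1 ^ j)) = if i = e₁ ∧ j = e₂ then s else 0 := by
    have hε0 := hε 0
    have hε1 := hε 1
    have y0 := r1 1
    have y1 := r5 1
    have y2 := r4 1
    have y3 := r2 1
    have y4 := r6 1
    simp only [hD.one, mul_zero, mul_one, neg_zero, smul_zero, add_zero, sub_zero]
      at y0 y1 y2 y3 y4
    intro e₁ e₂ i j h1 h2 h3 h4
    -- The sign is that of `D 1` passing `y 0`, which happens on the diagonal only for `e₁ = e₂ =
    -- 1`.
    refine ⟨(-1) ^ (e₁ * e₂), by simp, ?_⟩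
    interval_cases e₁ <;> interval_cases e₂ <;> interval_cases i <;> interval_cases j <;>
      simp [hε0, hε1, hD.one, r1, r2, y0, y1, y2, y3, y4]
  rintro ⟨e₁, e₂, e₃⟩ he
  obtain ⟨he₁, he₂, he₃⟩ := hS _ he
  simp only at he₁ he₂ he₃
  refine ⟨ε.toLinearMap ∘ₗ (D 0 ^ e₁ * D 1 ^ e₂) ∘ₗ H e₃, ?_, ?_, ?_⟩
  · rintro ⟨i, j, c⟩ he' hne hc
    obtain ⟨hi, hj, -⟩ := hS _ he'
    obtain ⟨s, -, hs⟩ := hH e₃ i j c hi hj hc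
    obtain ⟨s', -, hs'⟩ := hG e₁ e₂ i j he₁ he₂ hi hj
    simp only [LinearMap.comp_apply, hs]
    split_ifs with hce
    · rw [map_smul, map_smul, AlgHom.toLinearMap_apply, hs', if_neg, smul_zero]
      rintro ⟨rfl, rfl⟩
      exact hne (by rw [hce])
    · simp
  · obtain ⟨s, hs0, hs⟩ := hH e₃ e₁ e₂ e₃ he₁ he₂ le_rfl
    obtain ⟨s', hs0', hs'⟩ := hG e₁ e₂ e₁ e₂ he₁ he₂ he₁ he₂
    simp only [LinearMap.comp_apply, hs, if_true, map_smul, AlgHom.toLinearMap_apply, hs',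
      and_self, smul_eq_mul]
    -- For `q = 0` the exponent `e₃ / 2` is zero, because then `e₃ < 2`.
    have hq : (-q) ^ (e₃ / 2) ≠ 0 := by
      rcases he₃ with h | h
      · exact pow_ne_zero _ (neg_ne_zero.2 h)
      · rw [Nat.div_eq_of_lt h, pow_zero]
        exact one_ne_zero
    exact mul_ne_zero (mul_ne_zero hs0 (mul_ne_zero hq
      (Nat.cast_ne_zero.2 (Nat.factorial_ne_zero _)))) hs0'
  · intro hne w hw
    simp only [LinearMap.comp_apply, Module.End.mul_apply]
    by_cases h3 : e₃ = 0
    · subst h3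
      have hH0 : H 0 = 1 := by simp [H]
      rw [hH0, Module.End.one_apply]
      by_cases h2 : e₂ = 0
      · subst h2
        have h1 : e₁ ≠ 0 := fun h => hne (by rw [h]; rfl)
        simp [end_pow_apply_eq_zero (hw 0) h1]
      · simp [end_pow_apply_eq_zero (hw 1) h2]
    · have : H e₃ w = 0 := by
        simp only [H, Module.End.mul_apply]
        by_cases hd : e₃ / 2 = 0
        · rw [hd, pow_zero, Module.End.one_apply]
          exact end_pow_apply_eq_zero (hw 2) (by omega)
        · rw [end_pow_apply_eq_zero (f := Z) (by simp [hZa, hw 1]) hd, map_zero]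
      simp [this]

end Triangular

/-! ### Polynomial growth -/

section Growth

variable {k A : Type*} [Field k] [Ring A] [Algebra k A]

theorem fg_one_sup_pow {W : Submodule k A} (hW : W.FG) (n : ℕ) : ((1 ⊔ W) ^ n).FG :=
  Submodule.FG.pow (Submodule.FG.sup (by
    rw [Submodule.one_eq_span]; exact Submodule.fg_span_singleton 1) hW) n

theorem tendsto_add_div_log (d C : ℝ) :
    Filter.Tendsto (fun n : ℕ => ((d + C / Real.log n : ℝ) : EReal)) Filter.atTop
      (nhds (d : EReal)) := by
  refine (continuous_coe_real_ereal.tendsto d).comp ?_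
  have h : Filter.Tendsto (fun n : ℕ => C / Real.log n) Filter.atTop (nhds 0) :=
    Filter.Tendsto.const_div_atTop (Real.tendsto_log_atTop.comp tendsto_natCast_atTop_atTop) C
  simpa using h.const_add d

/-- If the dimensions of the powers of a finite-dimensional generating subspace grow like `n ^ d`,
then the Gelfand-Kirillov dimension is `d`. -/
theorem gkDim_eq_of_growth {W : Submodule k A} (hW : W.FG) (hgen : ∀ w, ∃ n, w ∈ (1 ⊔ W) ^ n)
    (d : ℕ) {c₁ c₂ : ℝ} (hc₁ : 0 < c₁) (hc₂ : 1 ≤ c₂)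
    (hlow : ∀ n : ℕ, 1 ≤ n → c₁ * n ^ d ≤ Module.finrank k ↥((1 ⊔ W) ^ n))
    (hupp : ∀ n : ℕ, 1 ≤ n → Module.finrank k ↥((1 ⊔ W) ^ n) ≤ c₂ * n ^ d) :
    gkDim k A = d := by
  apply le_antisymm
  · refine iSup_le fun ⟨U, hU⟩ => ?_
    obtain ⟨m, hm, hUm⟩ : ∃ m : ℕ, 1 ≤ m ∧ U ≤ (1 ⊔ W) ^ m := by
      obtain ⟨s, rfl⟩ := hU
      choose f hf using hgen
      -- The extra `1` makes `m` positive, so that the upper bound applies to `m * n`.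
      refine ⟨s.sup f + 1, by omega, Submodule.span_le.2 fun w hw => ?_⟩
      have h1 : f w ≤ s.sup f + 1 := (Finset.le_sup hw).trans (Nat.le_succ _)
      exact (pow_le_pow_right₀ le_sup_left h1 : (1 ⊔ W) ^ f w ≤ _) (hf w)
    have hle : ∀ n : ℕ, 2 ≤ n → Real.log (Module.finrank k ↥((1 ⊔ U) ^ n)) / Real.log n ≤
        d + (Real.log c₂ + d * Real.log m) / Real.log n := by
      intro n hn
      have hn' : (1 : ℝ) < n := by exact_mod_cast hn
      have hm' : (1 : ℝ) ≤ m := by exact_mod_cast hm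
      have hlog : 0 < Real.log n := Real.log_pos hn'
      have hsub : (1 ⊔ U) ^ n ≤ (1 ⊔ W) ^ (m * n) := by
        rw [pow_mul]
        refine pow_le_pow_left₀ bot_le (sup_le ?_ hUm) n
        exact one_le_pow₀ le_sup_left
      have hfin : Module.Finite k ↥((1 ⊔ W) ^ (m * n)) :=
        Module.Finite.iff_fg.2 (fg_one_sup_pow hW _)
      have h1 : (Module.finrank k ↥((1 ⊔ U) ^ n) : ℝ) ≤ c₂ * (m * n : ℝ) ^ d := by
        refine le_trans (Nat.cast_le.2 (Submodule.finrank_mono hsub)) ?_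
        simpa using hupp (m * n) (by nlinarith)
      have h2 : Real.log (c₂ * (m * n : ℝ) ^ d) =
          Real.log c₂ + d * Real.log m + d * Real.log n := by
        rw [Real.log_mul (by positivity) (by positivity), Real.log_pow,
          Real.log_mul (by positivity) (by positivity)]
        ring
      have h3 : Real.log (Module.finrank k ↥((1 ⊔ U) ^ n)) ≤
          Real.log c₂ + d * Real.log m + d * Real.log n := by
        rw [← h2]
        -- A zero rank has logarithm `0` by convention, and the bound is nonnegative since `c₂ ≥ 1`.
        rcases Nat.eq_zero_or_pos (Module.finrank k ↥((1 ⊔ U) ^ n)) with h0 | h0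
        · rw [h0, Nat.cast_zero, Real.log_zero]
          apply Real.log_nonneg
          have : (1 : ℝ) ≤ (m * n : ℝ) ^ d := one_le_pow₀ (by nlinarith)
          nlinarith
        · exact Real.log_le_log (by exact_mod_cast h0) h1
      rw [div_le_iff₀ hlog, add_mul, div_mul_cancel₀ _ hlog.ne']
      linarith
    have := (tendsto_add_div_log d (Real.log c₂ + d * Real.log m)).limsup_eq
    rw [show ((d : ℕ) : EReal) = ((d : ℝ) : EReal) by simp, ← this]
    refine Filter.limsup_le_limsup ?_
    filter_upwards [Filter.eventually_ge_atTop 2] with n hn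
    exact EReal.coe_le_coe_iff.2 (hle n hn)
  · refine le_trans ?_ (le_iSup _ (⟨W, hW⟩ : {W : Submodule k A // W.FG}))
    have := (tendsto_add_div_log d (Real.log c₁)).limsup_eq
    rw [show ((d : ℕ) : EReal) = ((d : ℝ) : EReal) by simp, ← this]
    refine Filter.limsup_le_limsup ?_
    filter_upwards [Filter.eventually_ge_atTop 2] with n hn
    refine EReal.coe_le_coe_iff.2 ?_
    have hn' : (1 : ℝ) < n := by exact_mod_cast hn
    have hlog : 0 < Real.log n := Real.log_pos hn'
    rw [le_div_iff₀ hlog, add_mul, div_mul_cancel₀ _ hlog.ne']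
    have := Real.log_le_log (by positivity) (hlow n (by omega))
    rw [Real.log_mul (by positivity) (by positivity), Real.log_pow] at this
    linarith

end Growth

/-! ### Spans of monomials -/

section MonSpan

variable {k A : Type*} [Field k] [Ring A] [Algebra k A]

/-- The exponents in `S` of total degree at most `n`. -/
def expLE (S : Set (ℕ × ℕ × ℕ)) (n : ℕ) : Set (ℕ × ℕ × ℕ) :=
  {e | e ∈ S ∧ e.1 + e.2.1 + e.2.2 ≤ n}

variable (k) in
/-- The span of the monomials with exponents in `S` of total degree at most `n`. -/
def monSpan (y : Fin 3 → A) (S : Set (ℕ × ℕ × ℕ)) (n : ℕ) : Submodule k A :=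
  Submodule.span k (mon y '' expLE S n)

variable {y : Fin 3 → A} {S : Set (ℕ × ℕ × ℕ)}

theorem mon_mem_monSpan {e : ℕ × ℕ × ℕ} (he : e ∈ S) {n : ℕ} (hn : e.1 + e.2.1 + e.2.2 ≤ n) :
    mon y e ∈ monSpan k y S n :=
  Submodule.subset_span ⟨e, ⟨he, hn⟩, rfl⟩

theorem monSpan_mono {m n : ℕ} (h : m ≤ n) : monSpan k y S m ≤ monSpan k y S n :=
  Submodule.span_mono (Set.image_mono fun _ he => ⟨he.1, he.2.trans h⟩)

theorem expLE_finite (S : Set (ℕ × ℕ × ℕ)) (n : ℕ) : (expLE S n).Finite := by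
  refine (Set.finite_Iic ((n, n, n) : ℕ × ℕ × ℕ)).subset fun e he => ?_
  have := he.2
  exact ⟨by simp only; omega, by simp only; omega, by simp only; omega⟩

variable (k) in
/-- Left multiplication by the `y j` raises the filtration by `monSpan` by at most one. -/
def IsStraightening (y : Fin 3 → A) (S : Set (ℕ × ℕ × ℕ)) : Prop :=
  0 ∈ S ∧ ∀ j, ∀ e ∈ S, y j * mon y e ∈ monSpan k y S (e.1 + e.2.1 + e.2.2 + 1)

namespace IsStraightening

theorem one_mem (h : IsStraightening k y S) : 1 ∈ monSpan k y S 0 := by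
  simpa [mon] using mon_mem_monSpan (k := k) (y := y) h.1 (n := 0) le_rfl

theorem mul_mem (h : IsStraightening k y S) (j : Fin 3) {n : ℕ} {w : A}
    (hw : w ∈ monSpan k y S n) : y j * w ∈ monSpan k y S (n + 1) := by
  induction hw using Submodule.span_induction with
  | mem w hw =>
    obtain ⟨e, he, rfl⟩ := hw
    exact monSpan_mono (Nat.add_le_add_right he.2 1) (h.2 j e he.1)
  | zero => simp
  | add u v _ _ hu hv => rw [mul_add]; exact add_mem hu hv
  | smul r u _ hu => rw [mul_smul_comm]; exact Submodule.smul_mem _ r hu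

/-- Straightening keeps products of at most `n` generators inside the span of ordered monomials of
degree at most `n`; conversely each such monomial is itself a product of that length. -/
theorem pow_eq_monSpan (h : IsStraightening k y S) (n : ℕ) :
    (1 ⊔ Submodule.span k (Set.range y)) ^ n = monSpan k y S n := by
  apply le_antisymm
  · induction n with
    | zero =>
      rw [pow_zero, Submodule.one_le]
      exact h.one_mem
    | succ n ih =>
      rw [pow_succ', Submodule.mul_le]
      intro u hu w hw
      obtain ⟨r, hr, v, hv, rfl⟩ := Submodule.mem_sup.1 hu
      obtain ⟨r, rfl⟩ := Submodule.mem_one.1 hr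
      rw [add_mul, ← Algebra.smul_def]
      refine add_mem (Submodule.smul_mem _ r (monSpan_mono (Nat.le_succ n) (ih hw))) ?_
      clear hu
      induction hv using Submodule.span_induction with
      | mem v hv =>
        obtain ⟨j, rfl⟩ := hv
        exact h.mul_mem j (ih hw)
      | zero => simp
      | add u v _ _ hu hv => rw [add_mul]; exact add_mem hu hv
      | smul r u _ hu => rw [smul_mul_assoc]; exact Submodule.smul_mem _ r hu
  · refine Submodule.span_le.2 ?_
    rintro _ ⟨e, he, rfl⟩
    refine (pow_le_pow_right₀ le_sup_left he.2 :
      (1 ⊔ Submodule.span k (Set.range y)) ^ (e.1 + e.2.1 + e.2.2) ≤ _) ?_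
    have hy : ∀ j, y j ∈ 1 ⊔ Submodule.span k (Set.range y) := fun j =>
      Submodule.mem_sup_right (Submodule.subset_span ⟨j, rfl⟩)
    rw [pow_add, pow_add]
    exact Submodule.mul_mem_mul (Submodule.mul_mem_mul (Submodule.pow_mem_pow _ (hy 0) _)
      (Submodule.pow_mem_pow _ (hy 1) _)) (Submodule.pow_mem_pow _ (hy 2) _)

theorem exists_mem (h : IsStraightening k y S)
    (hy : ∀ N : Submodule k A, 1 ∈ N → (∀ j, ∀ w ∈ N, y j * w ∈ N) → ∀ w, w ∈ N) (w : A) :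
    ∃ n, w ∈ monSpan k y S n := by
  have hdir : Directed (· ≤ ·) (monSpan k y S) :=
    Monotone.directed_le fun _ _ h => monSpan_mono h
  rw [← Submodule.mem_iSup_of_directed _ hdir]
  refine hy _ (Submodule.mem_iSup_of_mem 0 h.one_mem) (fun j w hw => ?_) w
  rw [Submodule.mem_iSup_of_directed _ hdir] at hw
  obtain ⟨n, hn⟩ := hw
  exact Submodule.mem_iSup_of_mem (n + 1) (h.mul_mem j hn)

theorem span_eq_top (h : IsStraightening k y S)
    (hy : ∀ N : Submodule k A, 1 ∈ N → (∀ j, ∀ w ∈ N, y j * w ∈ N) → ∀ w, w ∈ N) :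
    Submodule.span k (Set.range fun e : S => mon y e.1) = ⊤ := by
  refine eq_top_iff.2 fun w _ => ?_
  obtain ⟨n, hn⟩ := h.exists_mem hy w
  refine Submodule.span_mono ?_ hn
  rintro _ ⟨e, he, rfl⟩
  exact ⟨⟨e, he.1⟩, rfl⟩

theorem finrank_pow (h : IsStraightening k y S)
    (hli : LinearIndependent k (fun e : S => mon y e.1)) (n : ℕ) :
    Module.finrank k ↥((1 ⊔ Submodule.span k (Set.range y)) ^ n) = (expLE S n).ncard := by
  have hli' : LinearIndependent k (fun e : expLE S n => mon y e.1) :=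
    hli.comp (fun e : expLE S n => (⟨e.1, e.2.1⟩ : S)) fun e e' hee =>
      Subtype.ext (congrArg (fun s : S => s.1) hee)
  have := (expLE_finite S n).fintype
  rw [h.pow_eq_monSpan, monSpan, Set.image_eq_range, finrank_span_eq_card hli',
    Set.ncard_eq_toFinset_card', Set.toFinset_card]

theorem gkDim_eq (h : IsStraightening k y S)
    (hy : ∀ N : Submodule k A, 1 ∈ N → (∀ j, ∀ w ∈ N, y j * w ∈ N) → ∀ w, w ∈ N)
    (hli : LinearIndependent k (fun e : S => mon y e.1))
    (d : ℕ) {c₁ c₂ : ℝ} (hc₁ : 0 < c₁) (hc₂ : 1 ≤ c₂)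
    (hlow : ∀ n : ℕ, 1 ≤ n → c₁ * n ^ d ≤ (expLE S n).ncard)
    (hupp : ∀ n : ℕ, 1 ≤ n → (expLE S n).ncard ≤ c₂ * n ^ d) : gkDim k A = d := by
  refine gkDim_eq_of_growth (W := Submodule.span k (Set.range y))
    (Submodule.fg_span (Set.finite_range y)) (fun w => ?_) d hc₁ hc₂ ?_ ?_
  · obtain ⟨n, hn⟩ := h.exists_mem hy w
    exact ⟨n, h.pow_eq_monSpan n ▸ hn⟩
  · simpa only [h.finrank_pow hli] using hlow
  · simpa only [h.finrank_pow hli] using hupp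

end IsStraightening

/-- The commutator with `y 2` is a derivation sending `y 0` to `a • y 0 ^ 2` and `y 1` to `b • (y 0
* y 1)`, so it multiplies `y 0 ^ i * y 1 ^ j` by `(i * a + j * b) • y 0`. -/
theorem SymmRel.isStraightening {a b : k} (h : SymmRel a b y) : IsStraightening k y B3 := by
  refine ⟨trivial, ?_⟩
  have h1 : ∀ i, y 1 * y 0 ^ i = y 0 ^ i * y 1 := fun i =>
    ((show Commute (y 1) (y 0) from h.h10).pow_right i)
  have h20 : ∀ i : ℕ, y 2 * y 0 ^ i = y 0 ^ i * y 2 + (i * a) • y 0 ^ (i + 1) := fun i => by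
    induction i with
    | zero => simp
    | succ i ih =>
      rw [pow_succ, ← mul_assoc, ih, add_mul, mul_assoc, h.h20, mul_add, ← mul_assoc,
        mul_smul_comm, smul_mul_assoc, ← pow_succ, ← mul_assoc, ← pow_succ, ← pow_succ]
      push_cast
      module
  have h21 : ∀ j : ℕ, y 2 * y 1 ^ j = y 1 ^ j * y 2 + (j * b) • (y 0 * y 1 ^ j) := fun j => by
    induction j with
    | zero => simp
    | succ j ih =>
      have hc : y 1 ^ j * y 0 = y 0 * y 1 ^ j := (show Commute (y 1) (y 0) from h.h10).pow_left j
      rw [pow_succ, ← mul_assoc, ih, add_mul, mul_assoc, h.h21, mul_add, ← mul_assoc,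
        mul_smul_comm, smul_mul_assoc, ← mul_assoc, hc, mul_assoc]
      simp only [mul_assoc, ← pow_succ]
      push_cast
      module
  rintro j ⟨i₁, i₂, i₃⟩ -
  fin_cases j
  · have : y 0 * mon y (i₁, i₂, i₃) = mon y (i₁ + 1, i₂, i₃) := by
      simp [mon, pow_succ', mul_assoc]
    simp only [Fin.zero_eta, this]
    exact mon_mem_monSpan (Set.mem_univ _) (by simp only; omega)
  · have : y 1 * mon y (i₁, i₂, i₃) = mon y (i₁, i₂ + 1, i₃) := by
      simp only [mon, ← mul_assoc, h1]
      simp [pow_succ', mul_assoc]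
    simp only [Fin.mk_one, this]
    exact mon_mem_monSpan (Set.mem_univ _) (by simp only; omega)
  · have : y 2 * mon y (i₁, i₂, i₃) = mon y (i₁, i₂, i₃ + 1) +
        (i₁ * a + i₂ * b) • mon y (i₁ + 1, i₂, i₃) := by
      simp only [mon, ← mul_assoc, h20, add_mul]
      rw [mul_assoc _ (y 2), h21]
      simp only [mul_add, mul_smul_comm, smul_mul_assoc, add_mul, add_smul]
      simp only [pow_succ' (y 2), pow_succ (y 0), mul_assoc]
      abel
    simp only [Fin.reduceFinMk, this]
    exact add_mem (mon_mem_monSpan (Set.mem_univ _) (by simp only; omega))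
      (Submodule.smul_mem _ _ (mon_mem_monSpan (Set.mem_univ _) (by simp only; omega)))

/-- Common to both cases with `t = -1`: multiplying by a generator only produces ordered monomials
whose first two exponents are below `2` and whose last exponent grows by at most one. Whether these
lie in the span for `S` is left to the hypothesis. -/
theorem SkewRel.isStraightening_of_mem {b : k} (h : SkewRel b y) (h0 : 0 ∈ S)
    (hS : ∀ e ∈ S, e.1 < 2 ∧ e.2.1 < 2 ∧ ∀ i < 2, ∀ j < 2, ∀ c ≤ e.2.2 + 1,
      mon y (i, j, c) ∈ monSpan k y S (i + j + c)) : IsStraightening k y S := by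
  have h00 : ∀ w, y 0 * (y 0 * w) = 0 := fun w => by rw [← mul_assoc, h.h00, zero_mul]
  have h11 : ∀ w, y 1 * (y 1 * w) = 0 := fun w => by rw [← mul_assoc, h.h11, zero_mul]
  have h10 : ∀ w, y 1 * (y 0 * w) = -(y 0 * (y 1 * w)) := fun w => by
    rw [← mul_assoc, h.h10, neg_mul, mul_assoc]
  have h20 : ∀ w, y 2 * (y 0 * w) = -(y 0 * (y 2 * w)) := fun w => by
    rw [← mul_assoc, h.h20, neg_mul, mul_assoc]
  have h21 : ∀ w, y 2 * (y 1 * w) = -(y 1 * (y 2 * w)) + b • (y 0 * (y 1 * w)) := fun w => by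
    rw [← mul_assoc, h.h21]; simp [add_mul, mul_assoc]
  refine ⟨h0, ?_⟩
  rintro m ⟨i, j, c⟩ he
  obtain ⟨hi, hj, hmem⟩ := hS _ he
  simp only at hi hj hmem
  have hmem' : ∀ i' < 2, ∀ j' < 2, ∀ c' ≤ c + 1, i' + j' + c' ≤ i + j + c + 1 →
      mon y (i', j', c') ∈ monSpan k y S (i + j + c + 1) :=
    fun i' hi' j' hj' c' hc' hn => monSpan_mono hn (hmem i' hi' j' hj' c' hc')
  have e00 : mon y (0, 0, c) = y 2 ^ c := by simp [mon]
  have e10 : mon y (1, 0, c) = y 0 * y 2 ^ c := by simp [mon]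
  have e01 : mon y (0, 1, c) = y 1 * y 2 ^ c := by simp [mon]
  have e11 : mon y (1, 1, c) = y 0 * (y 1 * y 2 ^ c) := by simp [mon, mul_assoc]
  have f00 : mon y (0, 0, c + 1) = y 2 * y 2 ^ c := by simp [mon, pow_succ']
  have f10 : mon y (1, 0, c + 1) = y 0 * (y 2 * y 2 ^ c) := by simp [mon, pow_succ']
  have f01 : mon y (0, 1, c + 1) = y 1 * (y 2 * y 2 ^ c) := by simp [mon, pow_succ']
  have f11 : mon y (1, 1, c + 1) = y 0 * (y 1 * (y 2 * y 2 ^ c)) := by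
    simp [mon, mul_assoc, pow_succ']
  have m00 := hmem' 0 (by omega) 0 (by omega) (c + 1) le_rfl
  have m10 := hmem' 1 (by omega) 0 (by omega) (c + 1) le_rfl
  have m01 := hmem' 0 (by omega) 1 (by omega) (c + 1) le_rfl
  have m11 := hmem' 1 (by omega) 1 (by omega) (c + 1) le_rfl
  have n10 := hmem' 1 (by omega) 0 (by omega) c (Nat.le_succ c)
  have n01 := hmem' 0 (by omega) 1 (by omega) c (Nat.le_succ c)
  have n11 := hmem' 1 (by omega) 1 (by omega) c (Nat.le_succ c)
  rw [f00] at m00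
  rw [f10] at m10
  rw [f01] at m01
  rw [f11] at m11
  rw [e10] at n10
  rw [e01] at n01
  rw [e11] at n11
  interval_cases i <;> interval_cases j <;> fin_cases m <;>
    simp only [e00, e10, e01, e11, Fin.zero_eta, Fin.mk_one, Fin.reduceFinMk, h00, h11, h10, h20,
      h21, mul_neg, mul_zero, neg_zero, neg_neg, mul_add, mul_smul_comm, smul_zero, add_zero,
      Submodule.zero_mem, Submodule.neg_mem_iff] <;>
    first
    | exact m00 (by omega)
    | exact m10 (by omega)
    | exact m01 (by omega)
    | exact m11 (by omega)
    | exact n10 (by omega)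
    | exact n01 (by omega)
    | exact n11 (by omega)
    | exact add_mem (neg_mem (m01 (by omega))) (Submodule.smul_mem _ _ (n11 (by omega)))

theorem SkewRel.isStraightening {b : k} (h : SkewRel b y) : IsStraightening k y B1 := by
  refine h.isStraightening_of_mem (by simp [B1]) fun e he => ⟨he.1, he.2, ?_⟩
  intro i hi j hj c _
  exact mon_mem_monSpan (show _ ∈ B1 from ⟨hi, hj⟩) le_rfl

/-- Only `y 2 ^ 2` leads outside `B0`, and `h22` rewrites it. A factor `y 0` in front annihilates
the result; the two cases left at the end are those without it. -/
theorem SkewRel.isStraightening_ext {b p : k} (h : SkewRel b y)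
    (h22 : y 2 * y 2 = b • (y 0 * y 2) + p • (y 0 * y 1)) : IsStraightening k y B0 := by
  refine h.isStraightening_of_mem (by simp [B0]) fun e he => ⟨he.1, he.2.1, ?_⟩
  intro i hi j hj c hc
  have hc2 : c ≤ 2 := by have := he.2.2; omega
  rcases Nat.lt_or_ge c 2 with hlt | hge
  · exact mon_mem_monSpan (show _ ∈ B0 from ⟨hi, hj, hlt⟩) le_rfl
  · obtain rfl : c = 2 := by omega
    have h00 : ∀ w, y 0 * (y 0 * w) = 0 := fun w => by rw [← mul_assoc, h.h00, zero_mul]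
    have h10 : ∀ w, y 1 * (y 0 * w) = -(y 0 * (y 1 * w)) := fun w => by
      rw [← mul_assoc, h.h10, neg_mul, mul_assoc]
    have hm : ∀ i' < 2, ∀ j' < 2, ∀ c' < 2, ∀ n, i' + j' + c' ≤ n →
        mon y (i', j', c') ∈ monSpan k y B0 n :=
      fun i' hi' j' hj' c' hc' n hn => mon_mem_monSpan (show _ ∈ B0 from ⟨hi', hj', hc'⟩) hn
    have m1 : y 0 * y 2 ∈ monSpan k y B0 2 := by
      simpa [mon] using hm 1 (by omega) 0 (by omega) 1 (by omega) 2 (by omega)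
    have m2 : y 0 * y 1 ∈ monSpan k y B0 2 := by
      simpa [mon] using hm 1 (by omega) 1 (by omega) 0 (by omega) 2 (by omega)
    have m3 : y 0 * (y 1 * y 2) ∈ monSpan k y B0 3 := by
      simpa [mon, mul_assoc] using hm 1 (by omega) 1 (by omega) 1 (by omega) 3 (by omega)
    interval_cases i <;> interval_cases j <;>
      simp only [mon, pow_two (y 2), h22, pow_zero, pow_one, one_mul, mul_add, mul_smul_comm, h00,
        h10, h.h11, mul_assoc, mul_zero, smul_zero, add_zero, neg_zero, smul_neg, mul_neg,
        Submodule.zero_mem, Submodule.neg_mem_iff]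
    · exact add_mem (Submodule.smul_mem _ _ m1) (Submodule.smul_mem _ _ m2)
    · exact Submodule.smul_mem _ _ m3

/-! ### Counting exponents -/

/-- The exponents contain a cube of side `⌊n/3⌋ + 1` and lie in one of side `n + 1 ≤ 2n`, whence
`1/27` and `8`. -/
theorem ncard_expLE_B3 (n : ℕ) (hn : 1 ≤ n) :
    (1 / 27 : ℝ) * n ^ 3 ≤ (expLE B3 n).ncard ∧ ((expLE B3 n).ncard : ℝ) ≤ 8 * n ^ 3 := by
  constructor
  · let s : Finset (ℕ × ℕ × ℕ) := Finset.range (n / 3 + 1) ×ˢ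
      Finset.range (n / 3 + 1) ×ˢ Finset.range (n / 3 + 1)
    have h : s.card ≤ (expLE B3 n).ncard := by
      rw [← Set.ncard_coe_finset]
      refine Set.ncard_le_ncard (fun e he => ⟨trivial, ?_⟩) (expLE_finite _ _)
      simp only [s, Finset.coe_product, Finset.coe_range, Set.mem_prod, Set.mem_Iio] at he
      omega
    have hs : s.card = (n / 3 + 1) ^ 3 := by simp [s]; ring
    rw [hs] at h
    have h3 : (n : ℝ) ≤ 3 * ((n / 3 : ℕ) + 1 : ℝ) := by
      have : n ≤ 3 * (n / 3 + 1) := by omega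
      exact_mod_cast this
    have h' : (((n / 3 : ℕ) + 1 : ℝ)) ^ 3 ≤ (expLE B3 n).ncard := by exact_mod_cast h
    calc (1 / 27 : ℝ) * n ^ 3 ≤ 1 / 27 * (3 * ((n / 3 : ℕ) + 1 : ℝ)) ^ 3 := by gcongr
      _ = ((n / 3 : ℕ) + 1 : ℝ) ^ 3 := by ring
      _ ≤ _ := h'
  · let s : Finset (ℕ × ℕ × ℕ) := Finset.range (n + 1) ×ˢ
      Finset.range (n + 1) ×ˢ Finset.range (n + 1)
    have h : (expLE B3 n).ncard ≤ s.card := by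
      rw [← Set.ncard_coe_finset]
      refine Set.ncard_le_ncard (fun e he => ?_) s.finite_toSet
      have := he.2
      simp only [s, Finset.coe_product, Finset.coe_range, Set.mem_prod, Set.mem_Iio]
      omega
    have hs : s.card = (n + 1) ^ 3 := by simp [s]; ring
    rw [hs] at h
    have h' : ((expLE B3 n).ncard : ℝ) ≤ (n + 1 : ℝ) ^ 3 := by exact_mod_cast h
    have hn' : (1 : ℝ) ≤ n := by exact_mod_cast hn
    calc ((expLE B3 n).ncard : ℝ) ≤ (n + 1 : ℝ) ^ 3 := h'
      _ ≤ (2 * n : ℝ) ^ 3 := by gcongr; linarith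
      _ = _ := by ring

theorem ncard_expLE_B1 (n : ℕ) (hn : 1 ≤ n) :
    (1 : ℝ) * n ^ 1 ≤ (expLE B1 n).ncard ∧ ((expLE B1 n).ncard : ℝ) ≤ 8 * n ^ 1 := by
  constructor
  · let s : Finset (ℕ × ℕ × ℕ) := {0} ×ˢ {0} ×ˢ Finset.range (n + 1)
    have h : s.card ≤ (expLE B1 n).ncard := by
      rw [← Set.ncard_coe_finset]
      refine Set.ncard_le_ncard (fun e he => ?_) (expLE_finite _ _)
      simp only [s, Finset.coe_product, Finset.coe_range, Set.mem_prod, Set.mem_Iio,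
        Finset.coe_singleton, Set.mem_singleton_iff] at he
      exact ⟨⟨by omega, by omega⟩, by omega⟩
    have hs : s.card = n + 1 := by simp [s]
    rw [hs] at h
    rw [one_mul, pow_one]
    exact_mod_cast (Nat.le_succ n).trans h
  · let s : Finset (ℕ × ℕ × ℕ) := Finset.range 2 ×ˢ Finset.range 2 ×ˢ Finset.range (n + 1)
    have h : (expLE B1 n).ncard ≤ s.card := by
      rw [← Set.ncard_coe_finset]
      refine Set.ncard_le_ncard (fun e he => ?_) s.finite_toSet
      have h1 := he.1.1
      have h2 := he.1.2
      have := he.2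
      simp only [s, Finset.coe_product, Finset.coe_range, Set.mem_prod, Set.mem_Iio]
      omega
    have hs : s.card = 4 * (n + 1) := by simp [s]; ring
    rw [hs] at h
    have : (expLE B1 n).ncard ≤ 8 * n := by omega
    rw [pow_one]
    exact_mod_cast this

theorem B0_eq : B0 = ((Finset.range 2 ×ˢ Finset.range 2 ×ˢ Finset.range 2 :
    Finset (ℕ × ℕ × ℕ)) : Set (ℕ × ℕ × ℕ)) := by
  ext e
  simp [B0]

theorem ncard_expLE_B0 (n : ℕ) :
    (1 : ℝ) * n ^ 0 ≤ (expLE B0 n).ncard ∧ ((expLE B0 n).ncard : ℝ) ≤ 8 * n ^ 0 := by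
  rw [pow_zero, mul_one, mul_one]
  constructor
  · have : 0 < (expLE B0 n).ncard := by
      rw [Set.ncard_pos (expLE_finite _ _)]
      exact ⟨0, by simp [expLE, B0]⟩
    exact_mod_cast this
  · have h : (expLE B0 n).ncard ≤ B0.ncard :=
      Set.ncard_le_ncard (fun e he => he.1) (by rw [B0_eq]; exact Finset.finite_toSet _)
    nth_rw 2 [B0_eq] at h
    rw [Set.ncard_coe_finset] at h
    have : (expLE B0 n).ncard ≤ 8 := by
      refine h.trans ?_
      simp
    exact_mod_cast this

end MonSpan

/-! ### Presentations for `t = 1` and `t = -1`. -/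

section Presentation13

universe u

variable {k : Type u} [Field k]

theorem X_mul_induction {A : Type*} [Ring A] [Algebra k A]
    {π : TensorAlgebra k (Fin 3 → k) →ₐ[k] A} (hπ : Function.Surjective π) (N : Submodule k A)
    (h1 : 1 ∈ N) (hN : ∀ j, ∀ w ∈ N, π (X k j) * w ∈ N) : ∀ w, w ∈ N := by
  intro w
  obtain ⟨w, rfl⟩ := hπ w
  induction w using ι_mul_induction (Pi.basisFun k (Fin 3)) with
  | one => simpa using h1
  | ι_mul j w hw =>
    rw [← X_eq, map_mul]
    exact hN j _ hw
  | add u v hu hv => rw [map_add]; exact add_mem hu hv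
  | smul r u hu => rw [map_smul]; exact N.smul_mem r hu

/-- The map of `T(V)` that sends `V` to zero kills every quadratic element, hence descends. -/
theorem exists_augmentation {R : Set (TensorAlgebra k (Fin 3 → k))}
    (hR : ∀ r ∈ R, ∃ z, r = pairMul k (Fin 3 → k) z) :
    ∃ ε : Presented R →ₐ[k] k, ∀ j, ε (RingQuot.mkAlgHom k _ (X k j)) = 0 := by
  have h : ∀ z, TensorAlgebra.lift k (0 : (Fin 3 → k) →ₗ[k] k) (pairMul k (Fin 3 → k) z) = 0 := by
    intro z
    induction z using TensorProduct.induction_on with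
    | zero => simp
    | tmul v w => simp
    | add u v hu hv => simp [hu, hv]
  refine ⟨RingQuot.liftAlgHom k ⟨TensorAlgebra.lift k 0, ?_⟩, fun j => ?_⟩
  · rintro x y ⟨hx, rfl⟩
    obtain ⟨z, rfl⟩ := hR x hx
    rw [h, map_zero]
  · rw [RingQuot.liftAlgHom_mkAlgHom_apply]
    simp [X]

/-- A set `R` of quadratic relations respected by the skew derivations, for which the monomials
with exponents in `S` span and are separated by triangular functionals, presents the Nichols
algebra of `braiding13`. -/
theorem presentation13 (a b p q t : k) (ht : t ≠ 0) {R : Set (TensorAlgebra k (Fin 3 → k))}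
    {S : Set (ℕ × ℕ × ℕ)} (hR : ∀ r ∈ R, ∃ z, r = pairMul k (Fin 3 → k) z)
    (hskew : ∀ {A : Type u} [Ring A] [Algebra k A] (π : TensorAlgebra k (Fin 3 → k) →ₐ[k] A),
      (∀ r ∈ R, π r = 0) → ∀ r ∈ R,
        skewRep (Pi.basisFun k (Fin 3)) (coeff13 a b p q t) (fun j => π (X k j)) r = 0)
    (hstr : ∀ {A : Type u} [Ring A] [Algebra k A] (π : TensorAlgebra k (Fin 3 → k) →ₐ[k] A),
      (∀ r ∈ R, π r = 0) → IsStraightening k (fun j => π (X k j)) S)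
    (htri : ∀ {A : Type u} [Ring A] [Algebra k A] (y : Fin 3 → A) (D : Fin 3 → A →ₗ[k] A)
      (ε : A →ₐ[k] k), SkewCalculus (coeff13 a b p q t) y D → (∀ j, ε (y j) = 0) →
      (∀ N : Submodule k A, 1 ∈ N → (∀ j, ∀ w ∈ N, y j * w ∈ N) → ∀ w, w ∈ N) →
      HasTriangularFunctionals y D S) :
    (definingIdeal (braiding13 a b p q t ht) : Set (TensorAlgebra k (Fin 3 → k))) =
        TwoSidedIdeal.span R ∧
      IsMonomialBasis (braiding13 a b p q t ht) S ∧
      ∀ (d : ℕ) (c₁ c₂ : ℝ), 0 < c₁ → 1 ≤ c₂ →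
        (∀ n : ℕ, 1 ≤ n → c₁ * n ^ d ≤ (expLE S n).ncard ∧ (expLE S n).ncard ≤ c₂ * n ^ d) →
        gkDim k (NicholsAlgebra (braiding13 a b p q t ht)) = d := by
  set c := braiding13 a b p q t ht
  let π : TensorAlgebra k (Fin 3 → k) →ₐ[k] Presented R := RingQuot.mkAlgHom k _
  have hπs : Function.Surjective π := RingQuot.mkAlgHom_surjective k _
  have hπR : ∀ r ∈ R, π r = 0 := fun r hr =>
    (mkAlgHom_eq_zero_iff k R r).2 (TwoSidedIdeal.subset_span hr)
  obtain ⟨ε, hε⟩ := exists_augmentation hR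
  obtain ⟨D, hD⟩ := exists_skewCalculus (Pi.basisFun k (Fin 3)) (C := coeff13 a b p q t) R π rfl
    (by simpa only [X_eq] using hskew π hπR)
  simp only [← X_eq] at hD
  have hy := X_mul_induction hπs
  have hF := htri _ D ε hD hε hy
  have hspan := (hstr π hπR).span_eq_top hy
  have hJ : (definingIdeal c : Set (TensorAlgebra k (Fin 3 → k))) = TwoSidedIdeal.span R :=
    definingIdeal_eq_span (Pi.basisFun k (Fin 3)) c (braiding13_basisFun a b p q t ht) hR
      (π := π) rfl (D := D) (by simpa only [← X_eq] using hD) ε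
      (by simpa only [← X_eq] using hε) (hF.eq_algebraMap hspan)
  let ρ : TensorAlgebra k (Fin 3 → k) →ₐ[k] NicholsAlgebra c := RingQuot.mkAlgHom k _
  have hρs : Function.Surjective ρ := RingQuot.mkAlgHom_surjective k _
  have hρR : ∀ r ∈ R, ρ r = 0 := fun r hr => by
    have hr' : r ∈ definingIdeal c := by
      rw [← SetLike.mem_coe, hJ]
      exact TwoSidedIdeal.subset_span hr
    simpa using RingQuot.mkAlgHom_rel k
      (s := fun x y : TensorAlgebra k (Fin 3 → k) => x ∈ definingIdeal c ∧ y = 0) ⟨hr', rfl⟩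
  -- Independence of the monomials is pulled back along `f`; spanning and growth are obtained
  -- directly in `𝔅(V)`, where the relations `R` hold.
  let f : NicholsAlgebra c →ₐ[k] Presented R := RingQuot.liftAlgHom k ⟨π, by
    rintro x y ⟨hx, rfl⟩
    rw [map_zero]
    rw [← SetLike.mem_coe, hJ] at hx
    exact (mkAlgHom_eq_zero_iff k R x).2 hx⟩
  have hf : ∀ w, f (ρ w) = π w := fun w => RingQuot.liftAlgHom_mkAlgHom_apply k _ _ w
  have hli : LinearIndependent k (fun e : S => mon (fun j => ρ (X k j)) e.1) := by
    refine LinearIndependent.of_comp f.toLinearMap ?_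
    convert hF.linearIndependent using 2 with e
    simp [mon, hf]
  have hyρ := X_mul_induction hρs
  exact ⟨hJ, ⟨hli, (hstr ρ hρR).span_eq_top hyρ⟩, fun d c₁ c₂ h1 h2 h =>
    (hstr ρ hρR).gkDim_eq hyρ hli d h1 h2 (fun n hn => (h n hn).1) fun n hn => (h n hn).2⟩

theorem mem_range_pairMul (i j : Fin 3) :
    X k i * X k j ∈ LinearMap.range (pairMul k (Fin 3 → k)) :=
  ⟨x k i ⊗ₜ x k j, pairMul_tmul _ _⟩

theorem skewRep_X {A : Type*} [Ring A] [Algebra k A] (C : Fin 3 → Fin 3 → Fin 3 → Fin 3 → k)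
    (y : Fin 3 → A) : (fun j => skewRep (Pi.basisFun k (Fin 3)) C y (X k j)) = skewOp C y := by
  funext j
  rw [X_eq, skewRep_ι]

theorem presentation13_symm [CharZero k] (a b p q : k) (ht : (1 : k) ≠ 0) :
    (definingIdeal (braiding13 a b p q 1 ht) : Set (TensorAlgebra k (Fin 3 → k))) =
        TwoSidedIdeal.span (relSymm a b) ∧
      IsMonomialBasis (braiding13 a b p q 1 ht) B3 ∧
      gkDim k (NicholsAlgebra (braiding13 a b p q 1 ht)) = 3 := by
  refine And.imp_right (And.imp_right fun h3 => ?_)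
    (presentation13 a b p q 1 ht (R := relSymm a b) (S := B3) ?_ ?_ ?_ ?_)
  · exact h3 3 (1 / 27) 8 (by norm_num) (by norm_num) ncard_expLE_B3
  · intro r hr
    suffices h : r ∈ LinearMap.range (pairMul k (Fin 3 → k)) from
      h.elim fun z hz => ⟨z, hz.symm⟩
    have m := mem_range_pairMul (k := k)
    simp only [relSymm, Set.mem_insert_iff, Set.mem_singleton_iff, pow_two] at hr
    rcases hr with rfl | rfl | rfl
    · exact sub_mem (m _ _) (m _ _)
    · exact sub_mem (sub_mem (m _ _) (m _ _)) (Submodule.smul_mem _ _ (m _ _))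
    · exact sub_mem (sub_mem (m _ _) (m _ _)) (Submodule.smul_mem _ _ (m _ _))
  · intro A _ _ π hπ
    rw [symmRel_iff] at hπ ⊢
    rw [skewRep_X]
    exact hπ.skewOp
  · intro A _ _ π hπ
    exact ((symmRel_iff a b π).1 hπ).isStraightening
  · intro A _ _ y D ε hD hε _
    exact hD.hasTriangularFunctionals_symm ε hε

theorem presentation13_skew [CharZero k] (a b p q : k) (hq : q ≠ 0) (ht : (-1 : k) ≠ 0) :
    (definingIdeal (braiding13 a b p q (-1) ht) : Set (TensorAlgebra k (Fin 3 → k))) =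
        TwoSidedIdeal.span (relSkew b) ∧
      IsMonomialBasis (braiding13 a b p q (-1) ht) B1 ∧
      gkDim k (NicholsAlgebra (braiding13 a b p q (-1) ht)) = 1 := by
  refine And.imp_right (And.imp_right fun h3 => ?_)
    (presentation13 a b p q (-1) ht (R := relSkew b) (S := B1) ?_ ?_ ?_ ?_)
  · simpa using h3 1 1 8 (by norm_num) (by norm_num) ncard_expLE_B1
  · intro r hr
    suffices h : r ∈ LinearMap.range (pairMul k (Fin 3 → k)) from
      h.elim fun z hz => ⟨z, hz.symm⟩
    have m := mem_range_pairMul (k := k)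
    simp only [relSkew, Set.mem_insert_iff, Set.mem_singleton_iff, pow_two] at hr
    rcases hr with rfl | rfl | rfl | rfl | rfl
    · exact add_mem (m _ _) (m _ _)
    · exact add_mem (m _ _) (m _ _)
    · exact sub_mem (add_mem (m _ _) (m _ _)) (Submodule.smul_mem _ _ (m _ _))
    · exact m _ _
    · exact m _ _
  · intro A _ _ π hπ
    rw [skewRel_iff] at hπ ⊢
    rw [skewRep_X]
    exact hπ.skewOp
  · intro A _ _ π hπ
    exact ((skewRel_iff b π).1 hπ).isStraightening
  · intro A _ _ y D ε hD hε hy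
    exact hD.hasTriangularFunctionals_skew ε hε hy fun e he => ⟨he.1, he.2, Or.inl hq⟩

theorem presentation13_ext [CharZero k] (a b p : k) (ht : (-1 : k) ≠ 0) :
    (definingIdeal (braiding13 a b p 0 (-1) ht) : Set (TensorAlgebra k (Fin 3 → k))) =
        TwoSidedIdeal.span (relExt b p) ∧
      IsMonomialBasis (braiding13 a b p 0 (-1) ht) B0 ∧
      gkDim k (NicholsAlgebra (braiding13 a b p 0 (-1) ht)) = 0 := by
  refine And.imp_right (And.imp_right fun h3 => ?_)
    (presentation13 a b p 0 (-1) ht (R := relExt b p) (S := B0) ?_ ?_ ?_ ?_)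
  · simpa using h3 0 1 8 (by norm_num) (by norm_num) fun n _ => ncard_expLE_B0 n
  · intro r hr
    suffices h : r ∈ LinearMap.range (pairMul k (Fin 3 → k)) from
      h.elim fun z hz => ⟨z, hz.symm⟩
    have m := mem_range_pairMul (k := k)
    simp only [relExt, Set.mem_insert_iff, Set.mem_singleton_iff, pow_two] at hr
    rcases hr with rfl | rfl | rfl | rfl | rfl | rfl
    · exact add_mem (m _ _) (m _ _)
    · exact add_mem (m _ _) (m _ _)
    · exact sub_mem (add_mem (m _ _) (m _ _)) (Submodule.smul_mem _ _ (m _ _))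
    · exact m _ _
    · exact m _ _
    · exact sub_mem (sub_mem (m _ _) (Submodule.smul_mem _ _ (m _ _)))
        (Submodule.smul_mem _ _ (m _ _))
  · intro A _ _ π hπ
    rw [extRel_iff] at hπ ⊢
    have hX := fun j => congrFun (skewRep_X (coeff13 a b p 0 (-1)) fun j => π (X k j)) j
    simp only [hX]
    exact ⟨hπ.1.skewOp, hπ.1.skewOp_sq hπ.2⟩
  · intro A _ _ π hπ
    have := (extRel_iff b p π).1 hπ
    exact this.1.isStraightening_ext this.2
  · intro A _ _ y D ε hD hε hy
    exact hD.hasTriangularFunctionals_skew ε hε hy fun e he => ⟨he.1, he.2.1, Or.inr he.2.2⟩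

theorem finrank_of_isMonomialBasis_B0 (c : Braiding k (Fin 3 → k)) (h : IsMonomialBasis c B0) :
    Module.finrank k (NicholsAlgebra c) = 8 := by
  rw [Module.finrank_eq_nat_card_basis (Module.Basis.mk h.1 h.2.ge), Nat.card_coe_set_eq, B0_eq,
    Set.ncard_coe_finset]
  simp

/-! ### Absence of quadratic relations for `t² ≠ 1`. -/

@[simp]
theorem relations_one {V : Type*} [AddCommGroup V] [Module k V] (c : Braiding k V) :
    relations c 1 = ⊥ := by
  have : quantumSymmetrizer c 1 = 1 := by
    rw [quantumSymmetrizer, Fintype.sum_unique]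
    simp [reducedWord]
  rw [relations, this, Module.End.one_eq_id, LinearMap.ker_id, Submodule.map_bot]

/-- The coordinates of a quadratic relation are annihilated by `1 + c`. -/
theorem coord_add_sum_eq_zero {V ι : Type*} [AddCommGroup V] [Module k V] [Fintype ι]
    [DecidableEq ι] (c : Braiding k V) (e : Module.Basis ι k V) {C : ι → ι → ι → ι → k}
    (hC : ∀ i j, c.toMap (e i ⊗ₜ e j) = ∑ m, ∑ l, C i j m l • (e m ⊗ₜ[k] e l)) (μ : ι → ι → k)
    (h : ∑ i, ∑ j, μ i j • (TensorAlgebra.ι k (e i) * TensorAlgebra.ι k (e j)) ∈ relations c 2)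
    (m l : ι) : μ m l + ∑ i, ∑ j, μ i j * C i j m l = 0 := by
  have hu : TensorPower.toTensorAlgebra (pairEquiv k V (∑ i, ∑ j, μ i j • (e i ⊗ₜ[k] e j))) =
      ∑ i, ∑ j, μ i j • (TensorAlgebra.ι k (e i) * TensorAlgebra.ι k (e j)) := by
    simp [toTensorAlgebra_pairEquiv]
  have h1 := ((mem_relations_succ c e hC _).1 (hu ▸ h)) m
  have hι : ∀ i j, skewDeriv e C i (TensorAlgebra.ι k (e j)) = if i = j then 1 else 0 :=
    fun i j => by simpa using skewDeriv_ι_mul e C i j 1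
  rw [relations_one, Submodule.mem_bot, hu] at h1
  have hδ : ∀ i j, skewDeriv e C m (TensorAlgebra.ι k (e i) * TensorAlgebra.ι k (e j)) =
      (if m = i then TensorAlgebra.ι k (e j) else 0) +
        ∑ l, C i j m l • TensorAlgebra.ι k (e l) := fun i j => by
    rw [skewDeriv_ι_mul, Finset.sum_eq_single j (by intro n _ hn; simp [hι, hn]) (by simp)]
    simp [hι]
  have h2 : TensorAlgebra.ι k (∑ l, (μ m l + ∑ i, ∑ j, μ i j * C i j m l) • e l) = 0 := by
    rw [← h1]
    simp only [map_add, map_sum, map_smul, hδ, smul_add, add_smul, Finset.sum_add_distrib]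
    refine congrArg₂ (fun u v : TensorAlgebra k V => u + v) ?_ ?_
    · rw [eq_comm, Finset.sum_eq_single m (by intro i _ hi; simp [hi.symm]) (by simp)]
      simp
    · simp only [Finset.sum_smul, Finset.smul_sum, smul_smul]
      rw [Finset.sum_comm]
      exact Finset.sum_congr rfl fun i _ => Finset.sum_comm
  rw [TensorAlgebra.ι_eq_zero_iff] at h2
  exact (Fintype.linearIndependent_iff.1 e.linearIndependent) _ h2 l

/-- Up to triangular corrections `c` is `t` times the flip, so `1 + c` has diagonal entries `1 + t`
and blocks of determinant `1 - t²`. The coordinates are eliminated from `μ 2 2` down to `μ 0 0`,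
each step using only those already known to vanish. -/
theorem relations_two_eq_bot (a b p q t : k) (ht : t ≠ 0) (ht2 : t ^ 2 ≠ 1) :
    relations (braiding13 a b p q t ht) 2 = ⊥ := by
  refine (Submodule.eq_bot_iff _).2 fun u hu => ?_
  obtain ⟨z, rfl⟩ : ∃ z, pairMul k (Fin 3 → k) z = u := by
    obtain ⟨v, -, rfl⟩ := hu
    obtain ⟨z, rfl⟩ := (pairEquiv k (Fin 3 → k)).surjective v
    exact ⟨z, (toTensorAlgebra_pairEquiv z).symm⟩
  let e := Pi.basisFun k (Fin 3)
  obtain ⟨μ, rfl⟩ : ∃ μ : Fin 3 → Fin 3 → k, z = ∑ i, ∑ j, μ i j • (e i ⊗ₜ[k] e j) := by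
    refine ⟨fun i j => (e.tensorProduct e).repr z (i, j), ?_⟩
    conv_lhs => rw [← (e.tensorProduct e).sum_repr z, Fintype.sum_prod_type]
    simp [Module.Basis.tensorProduct_apply]
  have key := coord_add_sum_eq_zero _ e (braiding13_basisFun a b p q t ht) μ (by
    simpa using hu)
  have h : ∀ m l : Fin 3, (finProdFinEquiv (m, l) : Fin 9) =
      ⟨l + 3 * m, by omega⟩ := fun m l => rfl
  have h00 := key 0 0
  have h01 := key 0 1
  have h02 := key 0 2
  have h10 := key 1 0
  have h11 := key 1 1
  have h12 := key 1 2
  have h20 := key 2 0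
  have h21 := key 2 1
  have h22 := key 2 2
  simp [Fin.sum_univ_three, coeff13, h, R13] at h00 h01 h02 h10 h11 h12 h20 h21 h22
  have hpos : 1 + t ≠ 0 := fun h => ht2 (by linear_combination (t - 1) * h)
  have hsq : 1 - t ^ 2 ≠ 0 := fun h => ht2 (by linear_combination -h)
  have z22 : μ 2 2 = 0 := by
    refine (mul_eq_zero.1 (?_ : (1 + t) * μ 2 2 = 0)).resolve_left hpos
    linear_combination h22
  have z11 : μ 1 1 = 0 := by
    refine (mul_eq_zero.1 (?_ : (1 + t) * μ 1 1 = 0)).resolve_left hpos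
    linear_combination h11 - t * q * z22
  have z12 : μ 1 2 = 0 := by
    refine (mul_eq_zero.1 (?_ : (1 - t ^ 2) * μ 1 2 = 0)).resolve_left hsq
    linear_combination h12 - t * h21
  have z21 : μ 2 1 = 0 := by linear_combination h21 - t * z12
  have z02 : μ 0 2 = 0 := by
    refine (mul_eq_zero.1 (?_ : (1 - t ^ 2) * μ 0 2 = 0)).resolve_left hsq
    linear_combination h02 - t * h20 + (t * b + t ^ 2 * b) * z22
  have z20 : μ 2 0 = 0 := by linear_combination h20 - t * z02 - t * b * z22
  have z01 : μ 0 1 = 0 := by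
    refine (mul_eq_zero.1 (?_ : (1 - t ^ 2) * μ 0 1 = 0)).resolve_left hsq
    linear_combination h01 - t * h10 + (t * p + t ^ 2 * p) * z22 + t * b * z12 + t ^ 2 * b * z21
  have z10 : μ 1 0 = 0 := by linear_combination h10 - t * z01 - t * b * z21 - t * p * z22
  have z00 : μ 0 0 = 0 := by
    refine (mul_eq_zero.1 (?_ : (1 + t) * μ 0 0 = 0)).resolve_left hpos
    linear_combination h00 - t * a * z20 + t * a * z02 + t * a * b * z22
  simp [Fin.sum_univ_three, z00, z01, z02, z10, z11, z12, z20, z21, z22]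

end Presentation13

end Nichols

theorem proposition3p8 {k : Type*} [Field k] [CharZero k] (a b p q t : k) (ht : t ≠ 0) :
    let c := braiding13 a b p q t ht
    let x₁ := X k 0
    let x₂ := X k 1
    let x₃ := X k 2
    (t ^ 2 ≠ 1 → relations c 2 = ⊥) ∧
    (t = 1 →
      (definingIdeal c : Set (TensorAlgebra k (Fin 3 → k))) =
          TwoSidedIdeal.span {x₂ * x₁ - x₁ * x₂, x₃ * x₁ - x₁ * x₃ - a • x₁ ^ 2,
            x₃ * x₂ - x₂ * x₃ - b • (x₁ * x₂)} ∧
        IsMonomialBasis c B3 ∧ gkDim k (NicholsAlgebra c) = 3) ∧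
    (t = -1 → q ≠ 0 →
      (definingIdeal c : Set (TensorAlgebra k (Fin 3 → k))) =
          TwoSidedIdeal.span {x₂ * x₁ + x₁ * x₂, x₃ * x₁ + x₁ * x₃,
            x₃ * x₂ + x₂ * x₃ - b • (x₁ * x₂), x₁ ^ 2, x₂ ^ 2} ∧
        IsMonomialBasis c B1 ∧ gkDim k (NicholsAlgebra c) = 1) ∧
    (t = -1 → q = 0 →
      (definingIdeal c : Set (TensorAlgebra k (Fin 3 → k))) =
          TwoSidedIdeal.span {x₂ * x₁ + x₁ * x₂, x₃ * x₁ + x₁ * x₃,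
            x₃ * x₂ + x₂ * x₃ - b • (x₁ * x₂), x₁ ^ 2, x₂ ^ 2,
            x₃ ^ 2 - b • (x₁ * x₃) - p • (x₁ * x₂)} ∧
        IsMonomialBasis c B0 ∧ gkDim k (NicholsAlgebra c) = 0 ∧
        Module.finrank k (NicholsAlgebra c) = 8) := by
  intro c x₁ x₂ x₃
  refine ⟨relations_two_eq_bot a b p q t ht, ?_, ?_, ?_⟩
  · rintro rfl
    exact presentation13_symm a b p q ht
  · rintro rfl hq
    exact presentation13_skew a b p q hq ht
  · rintro rfl rfl
    obtain ⟨h1, h2, h3⟩ := presentation13_ext a b p ht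
    exact ⟨h1, h2, h3, finrank_of_isMonomialBasis_B0 _ h2⟩
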